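/- **Setting.** Let $d,n\ge 1$ and write $\langle X,B\rangle=\mathrm{trace}(XB)$ for $X,B\in\mathbb R^{d\times d}$. Let $(X,Y)\in\mathbb R^{d\times d}\times\mathbb R$ have law $\mathbf P$ and satisfy $Y=f^\star(\langle X,B^\star\rangle)+\epsilon$, where $B^\star$ is symmetric with $\|B^\star\|_F=1$ and $f^\star:\mathbb R\to\mathbb R$ is measurable; the data $\mathcal D_n=(X_i,Y_i)_{i\le n}$ are i.i.d. with law $\mathbf P$. Let $\mathcal S^d_{1,+}$ be the set of symmetric positive semidefinite $B\in\mathbb R^{d\times d}$ with $\|B\|_F=1$, and let $I\subseteq\mathbb R$ be an interval (for instance $I=[-1,1]$) such that $\langle X,B^\star\rangle\in I$ almost surely and, for each $B\in\mathcal S^d_{1,+}$, $\langle X,B\rangle\in I$ almost surely. Put $$R(B,f)=\mathbb E\big[(Y-f(\langle X,B\rangle))^2\big],\qquad r_n(B,f)=\frac1n\sum_{i=1}^n\big(Y_i-f(\langle X_i,B\rangle)\big)^2 .$$ **Assumption N.** $\mathbb E[\epsilon\mid X]=0$, and there are $\sigma,L>0$ with $\mathbb E[|\epsilon|^k\mid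 X]\le \frac{k!}{2}\sigma^2L^{k-2}$ almost surely for all integers $k\ge2$. **Assumption B.** Almost surely all entries of $X$ are bounded by $1$ in absolute value, and $|f^\star|\le C$ on $I$ for a constant $C\ge1$. **Dictionary.** $\varphi_1,\varphi_2,\dots$ are measurable functions which on $I$ take values in $[-1,1]$ and are differentiable with $|\varphi_j'|\le jC_\phi$, where $C_\phi>0$. For $M\ge1$ and $\Lambda>0$ let $\mathcal B_M(\Lambda)=\{\beta\in\mathbb R^M:\sum_{j=1}^M j|\beta_j|\le\Lambda,\ \beta_M\ne0\}$ and $\mathcal F_M(\Lambda)=\{\sum_{j=1}^M\beta_j\varphi_j:\beta\in\mathcal B_M(\Lambda)\}$. **Prior and estimator.** Let $\mu$ be the law of $V\,\mathrm{diag}(\gamma_1^{1/2},\dots,\gamma_d^{1/2})V^\top$, with $V$ Haar distributed on the orthogonal group and, independently of $V$, $\gamma\sim\mathrm{Dir}(\alpha_1,\dots,\alpha_d)$, where $\sum_i\alpha_i=1$ and $\alpha_i\ge D_1/d$ for all $i$, with a constant $D_1>0$ (for $\alpha_i=1/d$ one takes $D_1=1$). Let $\nu$ be the mixture over $1\le M\le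 n$, with weights proportional to $10^{-M}$, of the images on $\mathcal F_M(C+1)$ of the uniform distributions on $\mathcal B_M(C+1)$, and let $\pi=\mu\otimes\nu$. Put $w=64(C+1)\max(L,C+1)$, $C_1=8\big((C+1)^2+\sigma^2\big)$ and $$\lambda=\frac{n}{w+2C_1}.$$ Given the data, $(\hat B_\lambda,\hat f_\lambda)$ is drawn from the Gibbs posterior $\hat\rho_\lambda$, which has density $e^{-\lambda r_n(B,f)}\big/\int e^{-\lambda r_n}\,d\pi$ with respect to $\pi$. **Theorem.** Under Assumptions N and B there is a constant $\Xi>0$, depending only on $L,C,\sigma,C_\phi$ and the prior constant $D_1$ (hence only on $L,C,\sigma,C_\phi$ when $\alpha_i=1/d$), such that for every $\delta\in(0,1)$, with probability at least $1-\delta$ over the data $\mathcal D_n\sim\mathbf P^{\otimes n}$ and the draw from $\hat\rho_\lambda$, $$R(\hat B_\lambda,\hat f_\lambda)-R(B^\star,f^\star)\le\Xi\inf_{1\le M\le n}\ \inf_{(B,f)\in\mathcal S^d_{1,+}\times\mathcal F_M(C)}\Big\{R(B,f)-R(B^\star,f^\star)+\frac{M\log(Cn)+\mathrm{rank}(B)\,d\log(16n)+d\log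 d\,\log(2ne)+\log(2/\delta)}{n}\Big\}.$$ In particular, for every $M$ for which a minimizer $(B^\star_M,f^\star_M)$ of $R$ over $\mathcal S^d_{1,+}\times\mathcal F_M(C)$ exists, $(B,f)$ may be replaced by $(B^\star_M,f^\star_M)$. -/

import Mathlib

open MeasureTheory ProbabilityTheory

noncomputable section

namespace LowRankSIM

/-- Square real matrices of size `d`. -/
abbrev Mat (d : ℕ) := Matrix (Fin d) (Fin d) ℝ

/-- Matrices carry the product (that is, Borel) sigma-algebra. -/
instance matMeasurableSpace (d : ℕ) : MeasurableSpace (Mat d) :=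
  inferInstanceAs (MeasurableSpace (Fin d → Fin d → ℝ))

instance matBorelSpace (d : ℕ) : BorelSpace (Mat d) :=
  inferInstanceAs (BorelSpace (Fin d → Fin d → ℝ))

instance matSecondCountable (d : ℕ) : SecondCountableTopology (Mat d) :=
  inferInstanceAs (SecondCountableTopology (Fin d → Fin d → ℝ))

/-- The orthogonal group is compact. -/
instance orthogonalCompactSpace (d : ℕ) : CompactSpace (Matrix.orthogonalGroup (Fin d) ℝ) := by
  refine (isCompact_iff_compactSpace (s := (Matrix.orthogonalGroup (Fin d) ℝ : Set (Mat d)))).mp ?_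
  have hK : IsCompact (Set.pi Set.univ fun _ : Fin d =>
      Set.pi Set.univ fun _ : Fin d => Set.Icc (-1 : ℝ) 1) :=
    isCompact_univ_pi fun _ => isCompact_univ_pi fun _ => isCompact_Icc
  refine IsCompact.of_isClosed_subset (X := Mat d) hK ?_ ?_
  · have : (Matrix.orthogonalGroup (Fin d) ℝ : Set (Mat d)) = {A : Mat d | A * star A = 1} := by
      ext A
      exact Matrix.mem_orthogonalGroup_iff (Fin d) ℝ
    rw [this]
    exact isClosed_eq (by fun_prop) continuous_const
  · intro A hA i _ j _
    have h := entry_norm_bound_of_unitary hA i j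
    rw [Real.norm_eq_abs] at h
    exact abs_le.mp h

/-- The pairing `⟨X, B⟩ = trace (X B)`. -/
def pairing {d : ℕ} (X B : Mat d) : ℝ := (X * B).trace

/-- Symmetric matrices of Frobenius norm one. -/
def unitSymm (d : ℕ) : Set (Mat d) := {B | B.IsSymm ∧ ∑ i, ∑ j, B i j ^ 2 = 1}

/-- Symmetric positive semidefinite matrices of Frobenius norm one. -/
def unitPSD (d : ℕ) : Set (Mat d) := {B | B.PosSemidef ∧ ∑ i, ∑ j, B i j ^ 2 = 1}

/-- The dictionary `φ 1, φ 2, …` (the index `0` is not used), on the interval `I`: measurable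
functions with values in `[-1, 1]` on `I`, differentiable on `I`, with `|φ j '| ≤ j Cφ` on `I`. -/
structure IsDictionary (φ : ℕ → ℝ → ℝ) (I : Set ℝ) (Cφ : ℝ) : Prop where
  measurable : ∀ j, 1 ≤ j → Measurable (φ j)
  abs_le_one : ∀ j, 1 ≤ j → ∀ t ∈ I, |φ j t| ≤ 1
  differentiableOn : ∀ j, 1 ≤ j → DifferentiableOn ℝ (φ j) I
  abs_deriv_le : ∀ j, 1 ≤ j → ∀ t ∈ I, |derivWithin (φ j) I t| ≤ j * Cφ

/-- Coefficient vectors `(β 1, …, β M)` with `∑ j |β j| ≤ Λ` (weighted by `j`) and `β M ≠ 0`.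
The entry `β j` of the text is the value at the index `j - 1` of `Fin M`. -/
def coefBall (M : ℕ) (Λ : ℝ) : Set (Fin M → ℝ) :=
  {β | ∑ j : Fin M, ((j : ℝ) + 1) * |β j| ≤ Λ ∧ ∀ j : Fin M, (j : ℕ) + 1 = M → β j ≠ 0}

/-- The function `∑ β j φ j` with coefficient vector `β`. -/
def link (φ : ℕ → ℝ → ℝ) {M : ℕ} (β : Fin M → ℝ) : ℝ → ℝ :=
  fun t => ∑ j : Fin M, β j * φ ((j : ℕ) + 1) t

/-- The approximation class `ℱ_M(Λ)`. -/
def approxClass (φ : ℕ → ℝ → ℝ) (M : ℕ) (Λ : ℝ) : Set (ℝ → ℝ) :=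
  (fun β : Fin M → ℝ => link φ β) '' coefBall M Λ

/-- Expected squared risk of `(B, f)` under the law `P` of `(X, Y)`. -/
def risk {d : ℕ} (P : Measure (Mat d × ℝ)) (B : Mat d) (f : ℝ → ℝ) : ℝ :=
  ∫ z, (z.2 - f (pairing z.1 B)) ^ 2 ∂P

/-- Empirical squared risk of `(B, f)` on the sample `S`. -/
def empRisk {d n : ℕ} (S : Fin n → Mat d × ℝ) (B : Mat d) (f : ℝ → ℝ) : ℝ :=
  (1 / (n : ℝ)) * ∑ i, ((S i).2 - f (pairing (S i).1 B)) ^ 2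

/-- The noise `ε = Y - f⋆(⟨X, B⋆⟩)`, as a function of `(X, Y)`. -/
def noise {d : ℕ} (Bs : Mat d) (fs : ℝ → ℝ) (z : Mat d × ℝ) : ℝ := z.2 - fs (pairing z.1 Bs)

/-- The sigma-algebra generated by the covariate `X`. -/
abbrev sigmaX (d : ℕ) : MeasurableSpace (Mat d × ℝ) :=
  MeasurableSpace.comap Prod.fst (matMeasurableSpace d)

/-- The noise is conditionally centred given `X`, with conditional absolute moments of
sub-exponential growth. -/
structure AssumptionN {d : ℕ} (P : Measure (Mat d × ℝ)) (Bs : Mat d) (fs : ℝ → ℝ)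
    (σ L : ℝ) : Prop where
  integrable : ∀ k : ℕ, 2 ≤ k → Integrable (fun z => |noise Bs fs z| ^ k) P
  centred : P[noise Bs fs | sigmaX d] =ᵐ[P] 0
  moment_le : ∀ k : ℕ, 2 ≤ k →
    ∀ᵐ z ∂P, (P[fun z => |noise Bs fs z| ^ k | sigmaX d]) z
      ≤ (k.factorial : ℝ) / 2 * σ ^ 2 * L ^ (k - 2)

/-- The entries of `X` are almost surely bounded by `1`, and `f⋆` is bounded by `C` on `I`. -/
structure AssumptionB {d : ℕ} (P : Measure (Mat d × ℝ)) (fs : ℝ → ℝ) (I : Set ℝ)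
    (C : ℝ) : Prop where
  covariate : ∀ᵐ z ∂P, ∀ i j, |z.1 i j| ≤ 1
  link_le : ∀ t ∈ I, |fs t| ≤ C

/-- The uniform (Haar) probability measure on the orthogonal group. -/
def orthogonalHaar (d : ℕ) : Measure (Matrix.orthogonalGroup (Fin d) ℝ) :=
  Measure.haarMeasure ⊤

/-- The Dirichlet distribution, as the law of normalised independent `Gamma(α i, 1)` variables. -/
def dirichlet {d : ℕ} (α : Fin d → ℝ) : Measure (Fin d → ℝ) :=
  (Measure.pi fun i => gammaMeasure (α i) 1).map fun g i => g i / ∑ k, g k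

/-- The prior on the index matrix: the law of `V diag(√γ 1, …, √γ d) Vᵀ` with `V` uniform on the
orthogonal group and `γ` Dirichlet, independent. -/
def matrixPrior {d : ℕ} (α : Fin d → ℝ) : Measure (Mat d) :=
  ((orthogonalHaar d).prod (dirichlet α)).map fun p =>
    (p.1 : Mat d) * Matrix.diagonal (fun i => √(p.2 i)) * (p.1 : Mat d).transpose

/-- Extension of a coefficient vector by zeros. -/
def pad (M n : ℕ) (β : Fin M → ℝ) : Fin n → ℝ :=
  fun j => if h : (j : ℕ) < M then β ⟨j, h⟩ else 0

/-- The prior on the link function, carried by coefficient vectors: the mixture, with weights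
proportional to `10 ^ (-M)` for `1 ≤ M ≤ n`, of the uniform laws on `coefBall M (C + 1)`.
The factor `9 / (1 - (1/10)^n)` makes the weights sum to one. -/
def linkPrior (n : ℕ) (C : ℝ) : Measure (Fin n → ℝ) :=
  ∑ M ∈ Finset.Icc 1 n, ENNReal.ofReal (9 / (1 - (1 / 10 : ℝ) ^ n) * (1 / 10 : ℝ) ^ M) •
    (cond (volume : Measure (Fin M → ℝ)) (coefBall M (C + 1))).map (pad M n)

/-- The prior on pairs (index matrix, coefficients of the link function). -/
def prior {d : ℕ} (n : ℕ) (α : Fin d → ℝ) (C : ℝ) : Measure (Mat d × (Fin n → ℝ)) :=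
  (matrixPrior α).prod (linkPrior n C)

/-- The Gibbs posterior with inverse temperature `lam`: density proportional to
`exp (-lam * empRisk)` with respect to the prior. -/
def gibbs {d n : ℕ} (α : Fin d → ℝ) (φ : ℕ → ℝ → ℝ) (C lam : ℝ) (S : Fin n → Mat d × ℝ) :
    Measure (Mat d × (Fin n → ℝ)) :=
  (prior n α C).tilted fun θ => -lam * empRisk S θ.1 (link φ θ.2)

/-- The constant `w = 64 (C + 1) max(L, C + 1)`. -/
def wConst (C L : ℝ) : ℝ := 64 * (C + 1) * max L (C + 1)

/-- The constant `C₁ = 8 ((C + 1)² + σ²)`. -/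
def c1Const (C σ : ℝ) : ℝ := 8 * ((C + 1) ^ 2 + σ ^ 2)

/-- The inverse temperature `λ = n / (w + 2 C₁)`. -/
def invTemp (n : ℕ) (C σ L : ℝ) : ℝ := n / (wConst C L + 2 * c1Const C σ)

/-- The complexity term of the oracle inequality, for `M` coefficients and rank `r`. -/
def complexity (n d M r : ℕ) (C δ : ℝ) : ℝ :=
  (M * Real.log (C * n) + r * d * Real.log (16 * n)
    + d * Real.log d * Real.log (2 * n * Real.exp 1) + Real.log (2 / δ)) / n

end LowRankSIM

end

open LowRankSIM

/-! Put h = f(⟨X,B⟩) - f⋆(⟨X,B⋆⟩). The noise is conditionally centred and h depends on X only, so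
the excess risk of (B, f) is E h², and one observation contributes the excess loss h² - 2hε. With κ
= w + 2C₁, Bernstein's moment condition gives E exp(-(h² - 2hε)/κ) ≤ exp(-E h²/(2κ)) and E exp((h² -
2hε)/κ) ≤ exp(2 E h²/κ) (`lintegral_exp_excess_le`). Independence turns these into bounds for the
empirical excess risk at temperature λ = n/κ, with rates a = λ/2 and b = 2λ.

The Gibbs mass of {excess > t} is a ratio N/Z. By Fubini N has mean at most e^{-at}. For Z,
Cauchy-Schwarz on a set A of parameters of excess at most s gives Z ≥ π(A)²/W, where W has mean at
most e^{bs} π(A). Hence the bad mass is at most NW/π(A)², and its mean is at most δ once at ≥ bs +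
log(1/π(A)) + 2 log(1/δ) (`one_sub_le_lintegral_tilted`). No entropy or variational formula enters.

It remains to bound from below the prior mass of a neighbourhood of a competitor. For the
eigenvectors, a pigeonhole over cells and the invariance of Haar measure charge only rank(B) columns
(`le_orthogonalHaar_columns`); the eigenvalues are handled through independent Gamma variables
(`le_dirichlet`), the coefficients by scaling of volume (`le_linkPrior`). On a neighbourhood of
radius of order 1/n the excess is at most twice that of the competitor plus O(n⁻²)
(`risk_sub_risk_le`). For d ≥ n the complexity exceeds 1 and the bound is deterministic. The infimum
over competitors costs a factor 2: a single near-minimiser is used, so no union bound is needed. -/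

namespace LowRankSIM

open scoped ENNReal


/-! ### Bernstein-type exponential moments under conditional moment bounds. -/

section ConditionalMoments

variable {Ω : Type*} {m m0 : MeasurableSpace Ω} {P : Measure Ω}

/-- A conditional bound integrates against a bounded nonnegative weight. -/
lemma integral_mul_le_of_condExp_le [IsProbabilityMeasure P] (hm : m ≤ m0) {G X : Ω → ℝ}
    (hG : StronglyMeasurable[m] G) (hG0 : ∀ ω, 0 ≤ G ω) {K c : ℝ} (hGK : ∀ᵐ ω ∂P, G ω ≤ K)
    (hX : Integrable X P) (hc : ∀ᵐ ω ∂P, (P[X | m]) ω ≤ c) :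
    Integrable (fun ω => G ω * X ω) P ∧ ∫ ω, G ω * X ω ∂P ≤ ∫ ω, G ω * c ∂P := by
  have hb : ∀ᵐ ω ∂P, ‖G ω‖ ≤ K := by
    filter_upwards [hGK] with ω h
    rwa [Real.norm_of_nonneg (hG0 ω)]
  have hGm : AEStronglyMeasurable G P := (hG.mono hm).aestronglyMeasurable
  have hi : Integrable (G * X) P := hX.bdd_mul hGm hb
  refine ⟨hi, ?_⟩
  have h1 : ∫ ω, G ω * X ω ∂P = ∫ ω, G ω * (P[X | m]) ω ∂P := by
    rw [← integral_condExp hm (f := fun ω => G ω * X ω)]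
    exact integral_congr_ae (condExp_mul_of_stronglyMeasurable_left hG hi hX)
  rw [h1]
  refine integral_mono_ae (integrable_condExp.bdd_mul hGm hb)
    ((integrable_const c).bdd_mul hGm hb) ?_
  filter_upwards [hc] with ω h
  exact mul_le_mul_of_nonneg_left h (hG0 ω)

lemma integral_mul_eq_zero_of_condExp_eq_zero [IsProbabilityMeasure P] (hm : m ≤ m0)
    {G X : Ω → ℝ} (hG : StronglyMeasurable[m] G) {K : ℝ} (hGK : ∀ᵐ ω ∂P, |G ω| ≤ K)
    (hX : Integrable X P) (hc : P[X | m] =ᵐ[P] 0) :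
    Integrable (fun ω => G ω * X ω) P ∧ ∫ ω, G ω * X ω ∂P = 0 := by
  have hGm : AEStronglyMeasurable G P := (hG.mono hm).aestronglyMeasurable
  have hi : Integrable (G * X) P := hX.bdd_mul hGm hGK
  refine ⟨hi, ?_⟩
  rw [← integral_condExp hm (f := fun ω => G ω * X ω), ← integral_zero Ω ℝ (μ := P)]
  refine integral_congr_ae ((condExp_mul_of_stronglyMeasurable_left hG hi hX).trans ?_)
  filter_upwards [hc] with ω h
  simp [h]

lemma hasSum_abs_pow_add_two_div_factorial (x : ℝ) :
    HasSum (fun k : ℕ => |x| ^ (k + 2) / ((k + 2).factorial : ℝ)) (Real.exp |x| - 1 - |x|) := by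
  have h := NormedSpace.expSeries_div_hasSum_exp |x|
  rw [← Real.exp_eq_exp_ℝ] at h
  have h2 := (hasSum_nat_add_iff' (f := fun k : ℕ => |x| ^ k / (k.factorial : ℝ)) 2).mpr h
  have e : Real.exp |x| - 1 - |x| = Real.exp |x| -
      ∑ i ∈ Finset.range 2, |x| ^ i / (i.factorial : ℝ) := by
    norm_num [Finset.sum_range_succ, sub_sub]
  rw [e]
  exact h2

/-- The linear term keeps its sign, so that it can integrate to zero, while the remainder depends on
|x| only and is governed by absolute moments. For x ≤ 0 the inequality is sinh(-x) ≥ -x. -/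
lemma exp_le_one_add_self_add (x : ℝ) : Real.exp x ≤ 1 + x + (Real.exp |x| - 1 - |x|) := by
  rcases le_total 0 x with h | h
  · rw [abs_of_nonneg h]; linarith
  · rw [abs_of_nonpos h]
    have := Real.self_le_sinh_iff.mpr (neg_nonneg.mpr h)
    rw [Real.sinh_eq, neg_neg] at this
    linarith

/-- Bernstein's bound on a weighted exponential moment, from conditional moment bounds. -/
lemma lintegral_mul_exp_le [IsProbabilityMeasure P] (hm : m ≤ m0) {ε G u : Ω → ℝ} {σ L K : ℝ}
    (hL : 0 < L) (hε : Measurable ε)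
    (hint : ∀ k : ℕ, 2 ≤ k → Integrable (fun ω => |ε ω| ^ k) P)
    (hcent : P[ε | m] =ᵐ[P] 0)
    (hmom : ∀ k : ℕ, 2 ≤ k → ∀ᵐ ω ∂P, (P[fun ω => |ε ω| ^ k | m]) ω
      ≤ (k.factorial : ℝ) / 2 * σ ^ 2 * L ^ (k - 2))
    (hG : StronglyMeasurable[m] G) (hG0 : ∀ ω, 0 ≤ G ω) (hGK : ∀ᵐ ω ∂P, G ω ≤ K)
    (hu : StronglyMeasurable[m] u) (huL : ∀ᵐ ω ∂P, |u ω| * L ≤ 1 / 16) :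
    ∫⁻ ω, ENNReal.ofReal (G ω * Real.exp (u ω * ε ω)) ∂P
      ≤ ENNReal.ofReal (∫ ω, G ω * (1 + 8 / 15 * σ ^ 2 * u ω ^ 2) ∂P) := by
  have huK : ∀ᵐ ω ∂P, |u ω| ≤ 1 / 16 / L := by
    filter_upwards [huL] with ω h
    rwa [le_div_iff₀ hL]
  have hGm : Measurable G := (hG.mono hm).measurable
  have hum : Measurable u := (hu.mono hm).measurable
  have hεi : Integrable ε P := by
    have h2 : MemLp ε 2 P := by
      refine (memLp_two_iff_integrable_sq hε.aestronglyMeasurable).mpr ?_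
      simpa using hint 2 le_rfl
    exact h2.integrable (by norm_num)
  have hGbd : ∀ᵐ ω ∂P, ‖G ω‖ ≤ K := by
    filter_upwards [hGK] with ω h
    rwa [Real.norm_of_nonneg (hG0 ω)]
  have hGi : Integrable G P :=
    (integrable_const (1 : ℝ)).bdd_mul hGm.aestronglyMeasurable hGbd |>.congr (by simp)
  have hlin := integral_mul_eq_zero_of_condExp_eq_zero (P := P) hm (G := fun ω => G ω * u ω)
    (K := K * (1 / 16 / L)) (hG.mul hu) (by
      filter_upwards [hGK, huK] with ω h1 h2
      rw [abs_mul, abs_of_nonneg (hG0 ω)]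
      exact mul_le_mul h1 h2 (abs_nonneg _) ((hG0 ω).trans h1)) hεi hcent
  have hquad : Integrable (fun ω => G ω * (8 / 15 * σ ^ 2 * u ω ^ 2)) P := by
    refine Integrable.bdd_mul (c := K) ?_ hGm.aestronglyMeasurable hGbd
    refine Integrable.of_bound (C := 8 / 15 * σ ^ 2 * (1 / 16 / L) ^ 2)
      (by fun_prop) ?_
    filter_upwards [huK] with ω h
    rw [Real.norm_of_nonneg (by positivity), ← sq_abs (u ω)]
    gcongr
  set ψ : Ω → ℝ := fun ω => G ω * (Real.exp |u ω * ε ω| - 1 - |u ω * ε ω|) with hψ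
  have hψm : Measurable ψ := by fun_prop
  have hψ0 : ∀ ω, 0 ≤ ψ ω := fun ω => mul_nonneg (hG0 ω) (by
    have := Real.add_one_le_exp |u ω * ε ω|
    linarith)
  -- The weight G|u|^(k+2) is `m`-measurable, so the conditional moment bound applies to each term
  -- of the series; its (k+2)! cancels the one of the exponential and leaves a geometric term in
  -- |u|L.
  have hterm : ∀ k : ℕ, ∫⁻ ω, ENNReal.ofReal
      (G ω * (|u ω * ε ω| ^ (k + 2) / ((k + 2).factorial : ℝ))) ∂P ≤
      ∫⁻ ω, ENNReal.ofReal (G ω * u ω ^ 2 * (σ ^ 2 / 2) * (|u ω| * L) ^ k) ∂P := by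
    intro k
    have hb : ∀ᵐ ω ∂P, G ω * |u ω| ^ (k + 2) / ((k + 2).factorial : ℝ)
        ≤ K * (1 / 16 / L) ^ (k + 2) / ((k + 2).factorial : ℝ) := by
      filter_upwards [hGK, huK] with ω h1 h2
      have hK : 0 ≤ K := (hG0 ω).trans h1
      gcongr
    have hum' : StronglyMeasurable[m] fun ω => |u ω| := hu.norm
    have key := integral_mul_le_of_condExp_le (P := P) hm
      (G := fun ω => G ω * |u ω| ^ (k + 2) / ((k + 2).factorial : ℝ))
      (X := fun ω => |ε ω| ^ (k + 2))
      ((hG.measurable.mul (hum'.measurable.pow_const _)).div_const _).stronglyMeasurable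
      (fun ω => by have := hG0 ω; positivity) hb (hint (k + 2) (by omega))
      (hmom (k + 2) (by omega))
    have e1 : ∀ ω, G ω * (|u ω * ε ω| ^ (k + 2) / ((k + 2).factorial : ℝ))
        = G ω * |u ω| ^ (k + 2) / ((k + 2).factorial : ℝ) * |ε ω| ^ (k + 2) := fun ω => by
      rw [abs_mul, mul_pow]; ring
    have e2 : ∀ ω, G ω * u ω ^ 2 * (σ ^ 2 / 2) * (|u ω| * L) ^ k
        = G ω * |u ω| ^ (k + 2) / ((k + 2).factorial : ℝ) *
          (((k + 2).factorial : ℝ) / 2 * σ ^ 2 * L ^ (k + 2 - 2)) := fun ω => by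
      have : ((k + 2).factorial : ℝ) ≠ 0 := by positivity
      rw [← sq_abs (u ω), Nat.add_sub_cancel]
      field_simp
      ring
    simp_rw [e1, e2]
    have hbb : ∀ᵐ ω ∂P, ‖G ω * |u ω| ^ (k + 2) / ((k + 2).factorial : ℝ)‖
        ≤ K * (1 / 16 / L) ^ (k + 2) / ((k + 2).factorial : ℝ) := by
      filter_upwards [hb] with ω h
      rwa [Real.norm_of_nonneg (by have := hG0 ω; positivity)]
    rw [← ofReal_integral_eq_lintegral_ofReal key.1 (ae_of_all _ fun ω => by
        have := hG0 ω
        positivity),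
      ← ofReal_integral_eq_lintegral_ofReal ((integrable_const _).bdd_mul
        (by fun_prop) hbb) (ae_of_all _ fun ω => by
        have := hG0 ω
        positivity)]
    exact ENNReal.ofReal_le_ofReal key.2
  -- The series is summed with nonnegative integrals, where exchanging sum and integral is free;
  -- integrability of the exponential remainder is then a conclusion and not an assumption.
  have hψle : ∫⁻ ω, ENNReal.ofReal (ψ ω) ∂P ≤
      ∫⁻ ω, ENNReal.ofReal (G ω * (8 / 15 * σ ^ 2 * u ω ^ 2)) ∂P := by
    calc ∫⁻ ω, ENNReal.ofReal (ψ ω) ∂P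
        = ∫⁻ ω, ∑' k : ℕ, ENNReal.ofReal
          (G ω * (|u ω * ε ω| ^ (k + 2) / ((k + 2).factorial : ℝ))) ∂P := by
          refine lintegral_congr fun ω => ?_
          have h := (hasSum_abs_pow_add_two_div_factorial (u ω * ε ω)).mul_left (G ω)
          rw [← ENNReal.ofReal_tsum_of_nonneg (fun k => mul_nonneg (hG0 ω) (by positivity))
            h.summable, h.tsum_eq]
      _ = ∑' k : ℕ, ∫⁻ ω, ENNReal.ofReal
          (G ω * (|u ω * ε ω| ^ (k + 2) / ((k + 2).factorial : ℝ))) ∂P := by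
          refine lintegral_tsum fun k => ?_
          fun_prop
      _ ≤ ∑' k : ℕ, ∫⁻ ω, ENNReal.ofReal
          (G ω * u ω ^ 2 * (σ ^ 2 / 2) * (|u ω| * L) ^ k) ∂P := ENNReal.tsum_le_tsum hterm
      _ = ∫⁻ ω, ∑' k : ℕ, ENNReal.ofReal
          (G ω * u ω ^ 2 * (σ ^ 2 / 2) * (|u ω| * L) ^ k) ∂P := by
          refine (lintegral_tsum fun k => ?_).symm
          fun_prop
      _ ≤ _ := by
          refine lintegral_mono_ae ?_
          filter_upwards [huL] with ω h
          have h0 : 0 ≤ |u ω| * L := by positivity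
          have hs := (hasSum_geometric_of_lt_one h0 (by linarith)).mul_left
            (G ω * u ω ^ 2 * (σ ^ 2 / 2))
          rw [← ENNReal.ofReal_tsum_of_nonneg (fun k => by have := hG0 ω; positivity)
            hs.summable, hs.tsum_eq]
          refine ENNReal.ofReal_le_ofReal ?_
          -- Since |u|L ≤ 1/16, the geometric series is at most 16/15, whence the constant 8/15 =
          -- (1/2)(16/15).
          have hinv : (1 - |u ω| * L)⁻¹ ≤ 16 / 15 := by
            rw [inv_le_comm₀ (by linarith) (by norm_num)]
            linarith
          calc G ω * u ω ^ 2 * (σ ^ 2 / 2) * (1 - |u ω| * L)⁻¹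
              ≤ G ω * u ω ^ 2 * (σ ^ 2 / 2) * (16 / 15) := by
                have := hG0 ω
                gcongr
            _ = _ := by ring
  have hψi : Integrable ψ P := by
    refine ⟨hψm.aestronglyMeasurable, ?_⟩
    rw [hasFiniteIntegral_iff_ofReal (ae_of_all _ hψ0)]
    refine hψle.trans_lt ?_
    exact (hasFiniteIntegral_iff_ofReal (ae_of_all _ fun ω => by
      have := hG0 ω
      positivity)).mp hquad.2
  have hψint : ∫ ω, ψ ω ∂P ≤ ∫ ω, G ω * (8 / 15 * σ ^ 2 * u ω ^ 2) ∂P := by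
    rw [← ofReal_integral_eq_lintegral_ofReal hψi (ae_of_all _ hψ0),
      ← ofReal_integral_eq_lintegral_ofReal hquad (ae_of_all _ fun ω => by
        have := hG0 ω
        positivity)] at hψle
    refine (ENNReal.ofReal_le_ofReal_iff (integral_nonneg fun ω => ?_)).mp hψle
    have := hG0 ω
    positivity
  have hpt : ∀ ω, G ω * Real.exp (u ω * ε ω) ≤ G ω + G ω * u ω * ε ω + ψ ω := fun ω => by
    have := mul_le_mul_of_nonneg_left (exp_le_one_add_self_add (u ω * ε ω)) (hG0 ω)
    refine this.trans (le_of_eq ?_)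
    simp only [hψ]
    ring
  calc ∫⁻ ω, ENNReal.ofReal (G ω * Real.exp (u ω * ε ω)) ∂P
      ≤ ∫⁻ ω, ENNReal.ofReal (G ω + G ω * u ω * ε ω + ψ ω) ∂P :=
        lintegral_mono fun ω => ENNReal.ofReal_le_ofReal (hpt ω)
    _ = ENNReal.ofReal (∫ ω, (G ω + G ω * u ω * ε ω + ψ ω) ∂P) := by
        refine (ofReal_integral_eq_lintegral_ofReal ((hGi.add hlin.1).add hψi) ?_).symm
        exact ae_of_all _ fun ω =>
          (mul_nonneg (hG0 ω) (Real.exp_pos _).le).trans (hpt ω)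
    _ ≤ _ := by
        refine ENNReal.ofReal_le_ofReal ?_
        have e0 : ∫ ω, (G ω + G ω * u ω * ε ω + ψ ω) ∂P = ∫ ω, G ω ∂P + ∫ ω, ψ ω ∂P :=
          (integral_add (hGi.add hlin.1) hψi).trans (by
            congr 1
            exact (integral_add hGi hlin.1).trans (by rw [hlin.2, add_zero]))
        rw [e0]
        have e : ∀ ω, G ω * (1 + 8 / 15 * σ ^ 2 * u ω ^ 2)
          = G ω + G ω * (8 / 15 * σ ^ 2 * u ω ^ 2) := fun ω => by ring
        simp_rw [e]
        rw [integral_add hGi hquad]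
        linarith

/-- Used with v = h²/κ. The term 2v/15 is the price of the noise, and the decay of e^{-v} outweighs
it with half of v to spare. -/
lemma exp_neg_mul_le {v : ℝ} (h0 : 0 ≤ v) (h1 : v ≤ 1 / 16) :
    Real.exp (-v) * (1 + 2 / 15 * v) ≤ 1 - v / 2 := by
  have h : Real.exp (-v) ≤ (1 + v)⁻¹ := by
    rw [Real.exp_neg]
    exact inv_anti₀ (by linarith) (by linarith [Real.add_one_le_exp v])
  calc Real.exp (-v) * (1 + 2 / 15 * v) ≤ (1 + v)⁻¹ * (1 + 2 / 15 * v) := by gcongr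
    _ ≤ 1 - v / 2 := by
      rw [inv_mul_le_iff₀ (by linarith)]
      nlinarith

lemma exp_mul_le {v : ℝ} (h0 : 0 ≤ v) (h1 : v ≤ 1 / 16) :
    Real.exp v * (1 + 2 / 15 * v) ≤ 1 + 2 * v := by
  have h : Real.exp v ≤ (1 - v)⁻¹ := by
    rw [le_inv_comm₀ (Real.exp_pos _) (by linarith), ← Real.exp_neg]
    linarith [Real.add_one_le_exp (-v)]
  calc Real.exp v * (1 + 2 / 15 * v) ≤ (1 - v)⁻¹ * (1 + 2 / 15 * v) := by gcongr
    _ ≤ 1 + 2 * v := by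
      rw [inv_mul_le_iff₀ (by linarith)]
      nlinarith

/-- Exponential moments of the excess loss `h ^ 2 - 2 h ε` at inverse temperature `1 / κ`. -/
lemma lintegral_exp_excess_le [IsProbabilityMeasure P] (hm : m ≤ m0) {ε h : Ω → ℝ}
    {σ L b κ : ℝ}
    (hL : 0 < L) (hκ : 0 < κ) (hbκ : 16 * b ^ 2 ≤ κ) (hσκ : 16 * σ ^ 2 ≤ κ)
    (hLκ : 32 * b * L ≤ κ) (hε : Measurable ε)
    (hint : ∀ k : ℕ, 2 ≤ k → Integrable (fun ω => |ε ω| ^ k) P)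
    (hcent : P[ε | m] =ᵐ[P] 0)
    (hmom : ∀ k : ℕ, 2 ≤ k → ∀ᵐ ω ∂P, (P[fun ω => |ε ω| ^ k | m]) ω
      ≤ (k.factorial : ℝ) / 2 * σ ^ 2 * L ^ (k - 2))
    (hh : StronglyMeasurable[m] h) (hb : ∀ᵐ ω ∂P, |h ω| ≤ b) :
    ∫⁻ ω, ENNReal.ofReal (Real.exp (-((h ω ^ 2 - 2 * h ω * ε ω) / κ))) ∂P
        ≤ ENNReal.ofReal (Real.exp (-((∫ ω, h ω ^ 2 ∂P) / κ / 2))) ∧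
      ∫⁻ ω, ENNReal.ofReal (Real.exp ((h ω ^ 2 - 2 * h ω * ε ω) / κ)) ∂P
        ≤ ENNReal.ofReal (Real.exp (2 * ((∫ ω, h ω ^ 2 ∂P) / κ))) := by
  have hhm : Measurable h := (hh.mono hm).measurable
  have hv0 : ∀ ω, 0 ≤ h ω ^ 2 / κ := fun ω => by positivity
  have hv1 : ∀ᵐ ω ∂P, h ω ^ 2 / κ ≤ 1 / 16 := by
    filter_upwards [hb] with ω hω
    rw [div_le_iff₀ hκ, ← sq_abs (h ω)]
    nlinarith [pow_le_pow_left₀ (abs_nonneg (h ω)) hω 2]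
  have hhi : Integrable (fun ω => h ω ^ 2 / κ) P := by
    refine Integrable.of_bound (C := 1 / 16) (by fun_prop) ?_
    filter_upwards [hv1] with ω hω
    rwa [Real.norm_of_nonneg (hv0 ω)]
  have huL : ∀ s : ℝ, |s| = 2 / κ → ∀ᵐ ω ∂P, |s * h ω| * L ≤ 1 / 16 := by
    intro s hs
    filter_upwards [hb] with ω hω
    rw [abs_mul, hs]
    calc 2 / κ * |h ω| * L ≤ 2 / κ * b * L := by gcongr
      _ = 2 * b * L / κ := by ring
      _ ≤ 1 / 16 := by
        rw [div_le_iff₀ hκ]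
        linarith
  -- Here 16σ² ≤ κ enters: with |s| = 2/κ the noise term is (16σ²/κ)(2/15)(h²/κ).
  have hsv : ∀ s : ℝ, |s| = 2 / κ → ∀ ω, 1 + 8 / 15 * σ ^ 2 * (s * h ω) ^ 2
      ≤ 1 + 2 / 15 * (h ω ^ 2 / κ) := by
    intro s hs ω
    have e : (s * h ω) ^ 2 = 4 / κ * (h ω ^ 2 / κ) := by
      rw [mul_pow, ← sq_abs s, hs]
      field_simp
      norm_num
      ring
    rw [e]
    have : 8 / 15 * σ ^ 2 * (4 / κ * (h ω ^ 2 / κ)) = (16 * σ ^ 2 / κ) * (2 / 15 * (h ω ^ 2 / κ)) := by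
      ring
    rw [this]
    have h1 : 16 * σ ^ 2 / κ ≤ 1 := (div_le_one hκ).mpr hσκ
    have h2 : 0 ≤ 2 / 15 * (h ω ^ 2 / κ) := by positivity
    nlinarith
  have hint2 : ∫ ω, h ω ^ 2 / κ ∂P = (∫ ω, h ω ^ 2 ∂P) / κ := integral_div _ _
  have hexpint : ∀ s t : ℝ, |s| ≤ 1 → |t| = 2 / κ → Integrable (fun ω =>
      Real.exp (s * (h ω ^ 2 / κ)) * (1 + 8 / 15 * σ ^ 2 * (t * h ω) ^ 2)) P := by
    intro s t hs ht
    refine Integrable.of_bound (C := Real.exp (1 / 16) * (1 + 2 / 15 * (1 / 16)))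
      (by fun_prop) ?_
    filter_upwards [hv1] with ω hω
    rw [Real.norm_of_nonneg (by positivity)]
    have h1 : s * (h ω ^ 2 / κ) ≤ 1 / 16 := by
      have := mul_le_mul_of_nonneg_right ((le_abs_self s).trans hs) (hv0 ω)
      linarith
    have h2 := hsv t ht ω
    refine mul_le_mul (Real.exp_le_exp.mpr h1) (h2.trans ?_) (by positivity) (by positivity)
    linarith
  constructor
  · have key := lintegral_mul_exp_le (P := P) hm (G := fun ω => Real.exp (-1 * (h ω ^ 2 / κ)))
      (u := fun ω => 2 / κ * h ω) (K := 1) (σ := σ) hL hε hint hcent hmom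
      (Real.continuous_exp.comp_stronglyMeasurable
        (((hh.measurable.pow_const 2).div_const κ).const_mul (-1)).stronglyMeasurable)
      (fun ω => (Real.exp_pos _).le)
      (ae_of_all _ fun ω => by
        rw [Real.exp_le_one_iff]
        linarith [hv0 ω])
      (hh.const_mul _) (huL _ (abs_of_pos (by positivity)))
    calc _ = ∫⁻ ω, ENNReal.ofReal (Real.exp (-1 * (h ω ^ 2 / κ)) *
          Real.exp (2 / κ * h ω * ε ω)) ∂P := by
          refine lintegral_congr fun ω => ?_
          rw [← Real.exp_add]
          congr 2
          ring
      _ ≤ _ := key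
      _ ≤ _ := by
          refine ENNReal.ofReal_le_ofReal ?_
          calc _ ≤ ∫ ω, (1 - h ω ^ 2 / κ / 2) ∂P := by
                refine integral_mono_ae (hexpint (-1) (2 / κ) (by simp) (abs_of_pos (by positivity)))
                  ((integrable_const _).sub (hhi.div_const 2)) ?_
                filter_upwards [hv1] with ω hω
                refine le_trans ?_ (exp_neg_mul_le (hv0 ω) hω)
                rw [neg_one_mul]
                exact mul_le_mul_of_nonneg_left (hsv _ (abs_of_pos (by positivity)) ω)
                  (Real.exp_pos _).le
            _ = 1 - (∫ ω, h ω ^ 2 ∂P) / κ / 2 := by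
                rw [integral_sub (integrable_const _) (hhi.div_const 2), integral_div, hint2]
                simp
            _ ≤ _ := by linarith [Real.add_one_le_exp (-((∫ ω, h ω ^ 2 ∂P) / κ / 2))]
  · have key := lintegral_mul_exp_le (P := P) hm (G := fun ω => Real.exp (1 * (h ω ^ 2 / κ)))
      (u := fun ω => -(2 / κ) * h ω) (K := Real.exp (1 / 16)) (σ := σ) hL hε hint hcent hmom
      (Real.continuous_exp.comp_stronglyMeasurable
        (((hh.measurable.pow_const 2).div_const κ).const_mul 1).stronglyMeasurable)
      (fun ω => (Real.exp_pos _).le)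
      (by
        filter_upwards [hv1] with ω hω
        rw [one_mul]
        exact Real.exp_le_exp.mpr hω)
      (hh.const_mul _) (huL _ (by rw [abs_neg]; exact abs_of_pos (by positivity)))
    calc _ = ∫⁻ ω, ENNReal.ofReal (Real.exp (1 * (h ω ^ 2 / κ)) *
          Real.exp (-(2 / κ) * h ω * ε ω)) ∂P := by
          refine lintegral_congr fun ω => ?_
          rw [← Real.exp_add]
          congr 2
          ring
      _ ≤ _ := key
      _ ≤ _ := by
          refine ENNReal.ofReal_le_ofReal ?_
          have habs : |-(2 / κ)| = 2 / κ := by rw [abs_neg]; exact abs_of_pos (by positivity)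
          calc _ ≤ ∫ ω, (1 + 2 * (h ω ^ 2 / κ)) ∂P := by
                refine integral_mono_ae (hexpint 1 (-(2 / κ)) (by simp) habs)
                  ((integrable_const _).add (hhi.const_mul 2)) ?_
                filter_upwards [hv1] with ω hω
                refine le_trans ?_ (exp_mul_le (hv0 ω) hω)
                rw [one_mul]
                exact mul_le_mul_of_nonneg_left (hsv _ habs ω) (Real.exp_pos _).le
            _ = 1 + 2 * ((∫ ω, h ω ^ 2 ∂P) / κ) := by
                rw [integral_add (integrable_const _) (hhi.const_mul 2), integral_const_mul, hint2]
                simp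
            _ ≤ _ := by linarith [Real.add_one_le_exp (2 * ((∫ ω, h ω ^ 2 ∂P) / κ))]

end ConditionalMoments


/-! ### Concentration of a general Gibbs measure. -/

lemma lintegral_pi_prod_eq_pow {E : Type*} [MeasurableSpace E] {P : Measure E}
    [IsProbabilityMeasure P] (n : ℕ) {f : E → ℝ≥0∞} (hf : Measurable f) :
    ∫⁻ S : Fin n → E, ∏ i, f (S i) ∂(Measure.pi fun _ => P) = (∫⁻ z, f z ∂P) ^ n := by
  have hind : iIndepFun (fun i (S : Fin n → E) => f (S i)) (Measure.pi fun _ => P) :=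
    iIndepFun_pi (X := fun _ : Fin n => f) fun _ => hf.aemeasurable
  rw [lintegral_prod_eq_prod_lintegral_of_indepFun Finset.univ _ hind
    fun i => hf.comp (measurable_pi_apply i)]
  have : ∀ i : Fin n, ∫⁻ S : Fin n → E, f (S i) ∂(Measure.pi fun _ => P) = ∫⁻ z, f z ∂P :=
    fun i => (measurePreserving_eval (fun _ : Fin n => P) i).lintegral_comp hf
  simp [this]

/-- From x ≤ 1 follows x² ≤ x ≤ ab ≤ ((a + b)/2)². This replaces a product of two dependent random
variables, whose means are known only separately, by a sum. -/
lemma two_mul_le_add_of_le_mul {x a b : ℝ≥0∞} (h1 : x ≤ 1) (h : x ≤ a * b) :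
    2 * x ≤ a + b := by
  by_cases ha : a = ∞
  · simp [ha]
  by_cases hb : b = ∞
  · simp [hb]
  lift a to NNReal using ha
  lift b to NNReal using hb
  lift x to NNReal using (h1.trans_lt ENNReal.one_lt_top).ne
  norm_cast at *
  rw [← NNReal.coe_le_coe] at *
  push_cast at *
  refine abs_le_of_sq_le_sq' (a := 2 * (x : ℝ)) ?_ (by positivity) |>.2
  nlinarith [sq_nonneg ((a : ℝ) - b), x.2]

/-- Cauchy-Schwarz: the mass of a set is controlled by the integrals of `exp (-g)` and `exp g`. -/
lemma measure_sq_le_lintegral_exp_mul {Θ : Type*} [MeasurableSpace Θ] {μ : Measure Θ}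
    {g : Θ → ℝ} (hg : Measurable g) (A : Set Θ) :
    μ A ^ 2 ≤ (∫⁻ θ, ENNReal.ofReal (Real.exp (-g θ)) ∂μ) *
      ∫⁻ θ in A, ENNReal.ofReal (Real.exp (g θ)) ∂μ := by
  have h := ENNReal.lintegral_mul_le_Lp_mul_Lq (μ.restrict A) Real.HolderConjugate.two_two
    (f := fun θ => ENNReal.ofReal (Real.exp (-g θ / 2)))
    (g := fun θ => ENNReal.ofReal (Real.exp (g θ / 2))) (by fun_prop) (by fun_prop)
  have e1 : ∀ y : ℝ, ENNReal.ofReal (Real.exp (y / 2)) ^ (2 : ℝ) = ENNReal.ofReal (Real.exp y) := by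
    intro y
    rw [ENNReal.rpow_two, ← ENNReal.ofReal_pow (Real.exp_pos _).le, ← Real.exp_nat_mul]
    congr 2
    push_cast
    ring
  have e2 : ∀ y : ℝ, ENNReal.ofReal (Real.exp (-y / 2)) * ENNReal.ofReal (Real.exp (y / 2)) = 1 := by
    intro y
    rw [← ENNReal.ofReal_mul (Real.exp_pos _).le, ← Real.exp_add]
    simp [neg_div]
  simp only [Pi.mul_apply, e1, e2, lintegral_const, one_mul, Measure.restrict_apply_univ] at h
  have h2 := pow_le_pow_left' h 2
  rw [mul_pow, ← ENNReal.rpow_two, ← ENNReal.rpow_two, ← ENNReal.rpow_two, ← ENNReal.rpow_mul,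
    ← ENNReal.rpow_mul] at h2
  norm_num at h2
  refine h2.trans ?_
  gcongr
  exact Measure.restrict_le_self

/-- The Gibbs mass of a set, in terms of a recentred energy. -/
lemma tilted_neg_apply_eq {Θ : Type*} [MeasurableSpace Θ] {μ : Measure Θ}
    [IsProbabilityMeasure μ] {ℓ : Θ → ℝ} (hℓ : Measurable ℓ) (hℓ0 : ∀ θ, 0 ≤ ℓ θ) (b : ℝ)
    {s : Set Θ} (hs : MeasurableSet s) :
    (μ.tilted fun θ => -ℓ θ) s = (∫⁻ θ in s, ENNReal.ofReal (Real.exp (-(ℓ θ - b))) ∂μ) /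
      ∫⁻ θ, ENNReal.ofReal (Real.exp (-(ℓ θ - b))) ∂μ := by
  have hi : Integrable (fun θ => Real.exp (-ℓ θ)) μ := by
    refine Integrable.of_bound (C := 1) (by fun_prop) (ae_of_all _ fun θ => ?_)
    rw [Real.norm_of_nonneg (Real.exp_pos _).le, Real.exp_le_one_iff]
    linarith [hℓ0 θ]
  have hb : ∀ θ, ENNReal.ofReal (Real.exp (-(ℓ θ - b))) =
      ENNReal.ofReal (Real.exp b) * ENNReal.ofReal (Real.exp (-ℓ θ)) := fun θ => by
    rw [← ENNReal.ofReal_mul (Real.exp_pos _).le, ← Real.exp_add]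
    congr 2
    ring
  simp_rw [hb]
  rw [lintegral_const_mul _ (by fun_prop), lintegral_const_mul _ (by fun_prop),
    ENNReal.mul_div_mul_left _ _ (by simp [Real.exp_pos]) ENNReal.ofReal_ne_top,
    tilted_apply' _ _ hs]
  have hpos : 0 < ∫ θ, Real.exp (-ℓ θ) ∂μ := integral_exp_pos hi
  simp_rw [ENNReal.ofReal_div_of_pos hpos, div_eq_mul_inv]
  rw [lintegral_mul_const _ (by fun_prop), ofReal_integral_eq_lintegral_ofReal hi
    (ae_of_all _ fun θ => (Real.exp_pos _).le)]

/-- A draw from a Gibbs measure has small excess `e`, with high probability, as soon as the prior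
charges the points of small excess and the energy has the right exponential moments. -/
theorem one_sub_le_lintegral_tilted {Θ Ω : Type*} [MeasurableSpace Θ] [MeasurableSpace Ω]
    {μ : Measure Θ} [IsProbabilityMeasure μ] {Q : Measure Ω} [IsProbabilityMeasure Q]
    {ℓ : Θ → Ω → ℝ} (hℓ : Measurable (Function.uncurry ℓ)) (hℓ0 : ∀ θ ω, 0 ≤ ℓ θ ω)
    {ℓ₀ : Ω → ℝ} (hℓ₀ : Measurable ℓ₀) {e : Θ → ℝ} (he : Measurable e) {a b s t p δ : ℝ}
    (ha : 0 ≤ a) (hb : 0 ≤ b) (hp : 0 < p) (hδ : 0 < δ)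
    (hneg : ∀ᵐ θ ∂μ, ∫⁻ ω, ENNReal.ofReal (Real.exp (-(ℓ θ ω - ℓ₀ ω))) ∂Q
      ≤ ENNReal.ofReal (Real.exp (-(a * e θ))))
    (hpos : ∀ᵐ θ ∂μ, ∫⁻ ω, ENNReal.ofReal (Real.exp (ℓ θ ω - ℓ₀ ω)) ∂Q
      ≤ ENNReal.ofReal (Real.exp (b * e θ)))
    (hs : ENNReal.ofReal p ≤ μ {θ | e θ ≤ s})
    (ht : b * s + Real.log (1 / p) + 2 * Real.log (1 / δ) ≤ a * t) :
    ENNReal.ofReal (1 - δ) ≤ ∫⁻ ω, (μ.tilted fun θ => -ℓ θ ω) {θ | e θ ≤ t} ∂Q := by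
  have hgood : MeasurableSet {θ | e θ ≤ t} := measurableSet_le he measurable_const
  have hA : MeasurableSet {θ | e θ ≤ s} := measurableSet_le he measurable_const
  set A := {θ | e θ ≤ s} with hAdef
  set N : Ω → ℝ≥0∞ := fun ω => ∫⁻ θ in {θ | e θ ≤ t}ᶜ,
    ENNReal.ofReal (Real.exp (-(ℓ θ ω - ℓ₀ ω))) ∂μ with hN
  set W : Ω → ℝ≥0∞ := fun ω => ∫⁻ θ in A, ENNReal.ofReal (Real.exp (ℓ θ ω - ℓ₀ ω)) ∂μ with hW
  have hℓs : Measurable fun x : Ω × Θ => ℓ x.2 x.1 := hℓ.comp measurable_swap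
  have hNm : Measurable N := by
    refine Measurable.lintegral_prod_right (f := fun ω θ =>
      ENNReal.ofReal (Real.exp (-(ℓ θ ω - ℓ₀ ω)))) ?_
    simp only [Function.uncurry_def]
    fun_prop
  have hWm : Measurable W := by
    refine Measurable.lintegral_prod_right (f := fun ω θ =>
      ENNReal.ofReal (Real.exp (ℓ θ ω - ℓ₀ ω))) ?_
    simp only [Function.uncurry_def]
    fun_prop
  have hNint : ∫⁻ ω, N ω ∂Q ≤ ENNReal.ofReal (Real.exp (-(a * t))) := by
    rw [hN, lintegral_lintegral_swap (by simp only [Function.uncurry_def]; fun_prop)]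
    calc _ ≤ ∫⁻ θ in {θ | e θ ≤ t}ᶜ, ENNReal.ofReal (Real.exp (-(a * t))) ∂μ := by
          refine lintegral_mono_ae ?_
          filter_upwards [ae_restrict_of_ae hneg, ae_restrict_mem hgood.compl] with θ h1 h2
          refine h1.trans (ENNReal.ofReal_le_ofReal (Real.exp_le_exp.mpr ?_))
          have h3 : t < e θ := not_le.mp h2
          nlinarith
      _ ≤ _ := by
          rw [lintegral_const, Measure.restrict_apply_univ]
          exact mul_le_of_le_one_right' prob_le_one
  have hWint : ∫⁻ ω, W ω ∂Q ≤ ENNReal.ofReal (Real.exp (b * s)) * μ A := by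
    rw [hW, lintegral_lintegral_swap (by simp only [Function.uncurry_def]; fun_prop)]
    calc _ ≤ ∫⁻ θ in A, ENNReal.ofReal (Real.exp (b * s)) ∂μ := by
          refine lintegral_mono_ae ?_
          filter_upwards [ae_restrict_of_ae hpos, ae_restrict_mem hA] with θ h1 h2
          refine h1.trans (ENNReal.ofReal_le_ofReal (Real.exp_le_exp.mpr ?_))
          exact mul_le_mul_of_nonneg_left h2 hb
      _ = _ := by rw [lintegral_const, Measure.restrict_apply_univ]
  have hq0 : μ A ≠ 0 := fun h0 => by
    rw [h0] at hs
    simp only [nonpos_iff_eq_zero, ENNReal.ofReal_eq_zero] at hs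
    linarith
  have hq1 : μ A ≠ ∞ := measure_ne_top _ _
  -- This scale balances the two summands of the arithmetic-geometric mean inequality: each of u·N
  -- and W/(u·μ(A)²) has mean at most δ.
  set u : ℝ := Real.exp (b * s) / (p * δ) with hu
  have hu0 : 0 < u := by positivity
  set F : Ω → ℝ≥0∞ := fun ω => (ENNReal.ofReal u * N ω +
    (ENNReal.ofReal u * μ A ^ 2)⁻¹ * W ω) / 2 with hF
  have hFm : Measurable F := by fun_prop
  have hut : ENNReal.ofReal u ≠ ∞ := ENNReal.ofReal_ne_top
  have hun : ENNReal.ofReal u ≠ 0 := by simpa using hu0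
  have hbound : ∀ ω, (μ.tilted fun θ => -ℓ θ ω) {θ | e θ ≤ t}ᶜ ≤ F ω := by
    intro ω
    have hm : Measurable fun θ => ℓ θ ω := hℓ.comp (measurable_id.prodMk measurable_const)
    rw [hF, ENNReal.le_div_iff_mul_le (by simp) (by simp), mul_comm]
    -- The scale u cancels in the product of the two summands, so only N/Z ≤ N·W/μ(A)² has to be
    -- checked, which is Cauchy-Schwarz for Z.
    refine two_mul_le_add_of_le_mul prob_le_one ?_
    rw [tilted_neg_apply_eq hm (fun θ => hℓ0 θ ω) (ℓ₀ ω) hgood.compl]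
    have hCS := measure_sq_le_lintegral_exp_mul (μ := μ) (g := fun θ => ℓ θ ω - ℓ₀ ω)
      (by fun_prop) A
    set Z := ∫⁻ θ, ENNReal.ofReal (Real.exp (-(ℓ θ ω - ℓ₀ ω))) ∂μ with hZ
    change μ A ^ 2 ≤ Z * W ω at hCS
    change N ω / Z ≤ _
    have e1 : ENNReal.ofReal u * N ω * ((ENNReal.ofReal u * μ A ^ 2)⁻¹ * W ω) =
        N ω * ((μ A ^ 2)⁻¹ * W ω) := by
      rw [ENNReal.mul_inv (Or.inl hun) (Or.inl hut)]
      calc _ = (ENNReal.ofReal u * (ENNReal.ofReal u)⁻¹) * (N ω * ((μ A ^ 2)⁻¹ * W ω)) := by ring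
        _ = _ := by rw [ENNReal.mul_inv_cancel hun hut, one_mul]
    rw [e1, div_eq_mul_inv]
    gcongr
    rw [ENNReal.inv_le_iff_inv_le, ENNReal.mul_inv (Or.inl (by simp [hq1])) (Or.inl (by simp [hq0])),
      inv_inv, ← div_eq_mul_inv]
    exact ENNReal.div_le_of_le_mul hCS
  have hFint : ∫⁻ ω, F ω ∂Q ≤ ENNReal.ofReal δ := by
    simp only [hF, div_eq_mul_inv]
    rw [lintegral_mul_const _ (by fun_prop), lintegral_add_left (by fun_prop),
      lintegral_const_mul _ hNm, lintegral_const_mul _ hWm, ← div_eq_mul_inv]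
    refine ENNReal.div_le_of_le_mul ?_
    rw [mul_two]
    refine add_le_add ?_ ?_
    · calc _ ≤ ENNReal.ofReal u * ENNReal.ofReal (Real.exp (-(a * t))) := by gcongr
        _ = ENNReal.ofReal (u * Real.exp (-(a * t))) := (ENNReal.ofReal_mul hu0.le).symm
        _ ≤ _ := by
          refine ENNReal.ofReal_le_ofReal ?_
          have e2 : u * Real.exp (-(a * t)) =
              Real.exp (b * s + Real.log (1 / p) + 2 * Real.log (1 / δ) - a * t) * δ := by
            rw [sub_eq_add_neg, Real.exp_add, Real.exp_add, Real.exp_add,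
              Real.exp_log (by positivity), two_mul, Real.exp_add, Real.exp_log (by positivity), hu]
            field_simp
          rw [e2]
          refine mul_le_of_le_one_left hδ.le ?_
          rw [Real.exp_le_one_iff]
          linarith
    · calc _ ≤ (ENNReal.ofReal u * μ A ^ 2)⁻¹ * (ENNReal.ofReal (Real.exp (b * s)) * μ A) := by
            gcongr
        _ = ENNReal.ofReal (Real.exp (b * s)) * (ENNReal.ofReal u)⁻¹ * (μ A)⁻¹ := by
            rw [ENNReal.mul_inv (Or.inl hun) (Or.inl hut), sq,
              ENNReal.mul_inv (Or.inl hq0) (Or.inl hq1)]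
            calc _ = ENNReal.ofReal (Real.exp (b * s)) * (ENNReal.ofReal u)⁻¹ * (μ A)⁻¹ *
                  (μ A * (μ A)⁻¹) := by ring
              _ = _ := by rw [ENNReal.mul_inv_cancel hq0 hq1, mul_one]
        _ ≤ ENNReal.ofReal (Real.exp (b * s)) * (ENNReal.ofReal u)⁻¹ * (ENNReal.ofReal p)⁻¹ := by
            gcongr
        _ = ENNReal.ofReal δ := by
            rw [← ENNReal.ofReal_inv_of_pos hu0, ← ENNReal.ofReal_inv_of_pos hp,
              ← ENNReal.ofReal_mul (Real.exp_pos _).le, ← ENNReal.ofReal_mul (by positivity)]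
            congr 1
            rw [hu]
            field_simp
  calc ENNReal.ofReal (1 - δ) = 1 - ENNReal.ofReal δ := by
        rw [ENNReal.ofReal_sub _ hδ.le, ENNReal.ofReal_one]
    _ ≤ ∫⁻ _, 1 ∂Q - ∫⁻ ω, F ω ∂Q := by
        simp only [lintegral_const, measure_univ, mul_one]
        exact tsub_le_tsub_left hFint 1
    _ ≤ ∫⁻ ω, (1 - F ω) ∂Q := lintegral_sub_le _ _ hFm
    _ ≤ _ := by
        refine lintegral_mono fun ω => ?_
        have hm : Measurable fun θ => ℓ θ ω := hℓ.comp (measurable_id.prodMk measurable_const)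
        have : IsProbabilityMeasure (μ.tilted fun θ => -ℓ θ ω) := by
          refine isProbabilityMeasure_tilted ?_
          refine Integrable.of_bound (C := 1) (by fun_prop) (ae_of_all _ fun θ => ?_)
          rw [Real.norm_of_nonneg (Real.exp_pos _).le, Real.exp_le_one_iff]
          linarith [hℓ0 θ ω]
        rw [← compl_compl {θ | e θ ≤ t}, prob_compl_eq_one_sub hgood.compl]
        simpa using tsub_le_tsub_left (hbound ω) 1


/-! ### Small-ball bounds for the matrix prior: Haar eigenvectors, Dirichlet eigenvalues. -/

instance isProbabilityMeasure_orthogonalHaar (d : ℕ) :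
    IsProbabilityMeasure (orthogonalHaar d) :=
  ⟨Measure.haarMeasure_self (K₀ := ⊤)⟩

instance isMulLeftInvariant_orthogonalHaar (d : ℕ) :
    (orthogonalHaar d).IsMulLeftInvariant := by
  unfold orthogonalHaar
  infer_instance

lemma abs_sub_le_of_floor_eq {K : ℕ} (hK : 0 < K) {x y : ℝ} (hx : -1 ≤ x) (hy : -1 ≤ y)
    (h : ⌊(x + 1) * K⌋₊ = ⌊(y + 1) * K⌋₊) : |x - y| ≤ 1 / K := by
  have hK' : (0 : ℝ) < K := by exact_mod_cast hK
  have h1 := Nat.floor_le (a := (x + 1) * K) (mul_nonneg (by linarith) hK'.le)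
  have h2 := Nat.floor_le (a := (y + 1) * K) (mul_nonneg (by linarith) hK'.le)
  have h3 := Nat.lt_floor_add_one ((x + 1) * K)
  have h4 := Nat.lt_floor_add_one ((y + 1) * K)
  rw [h] at h1 h3
  have e : |x - y| * K = |(x - y) * K| := by rw [abs_mul, abs_of_pos hK']
  rw [le_div_iff₀ hK', e, abs_le]
  constructor <;> linarith

lemma abs_entry_le_one {d : ℕ} (V : Matrix.orthogonalGroup (Fin d) ℝ) (i j : Fin d) :
    |(V : Mat d) i j| ≤ 1 := by
  simpa using entry_norm_bound_of_unitary V.2 i j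

/-- Haar measure charges the orthogonal matrices whose columns indexed by `J` are close to
those of a given one: there are few cells to distinguish them, and all translate to one. -/
lemma le_orthogonalHaar_columns {d : ℕ} (U : Matrix.orthogonalGroup (Fin d) ℝ)
    (J : Finset (Fin d)) {K : ℕ} (hK : 0 < K) :
    (((2 * K + 1 : ℕ) : ℝ≥0∞) ^ (d * J.card))⁻¹ ≤ orthogonalHaar d
      {V | ∀ i, ∀ k ∈ J, |(V : Mat d) i k - (U : Mat d) i k| ≤ d / K} := by
  set good := {V : Matrix.orthogonalGroup (Fin d) ℝ |
    ∀ i, ∀ k ∈ J, |(V : Mat d) i k - (U : Mat d) i k| ≤ d / K} with hgood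
  have hK' : (0 : ℝ) < K := by exact_mod_cast hK
  -- Entries lie in [-1,1], so the shifted and scaled entry has its floor in {0, …, 2K}: there are
  -- 2K + 1 values for each of the d·|J| recorded entries.
  let cell : Matrix.orthogonalGroup (Fin d) ℝ → (Fin d × J → Fin (2 * K + 1)) := fun V x =>
    ⟨⌊((V : Mat d) x.1 x.2 + 1) * K⌋₊, by
      rw [Nat.lt_succ_iff]
      refine Nat.floor_le_of_le ?_
      push_cast
      have := (abs_le.mp (abs_entry_le_one V x.1 x.2)).2
      nlinarith⟩
  have hfib : ∀ c, orthogonalHaar d (cell ⁻¹' {c}) ≤ orthogonalHaar d good := by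
    intro c
    rcases (cell ⁻¹' {c}).eq_empty_or_nonempty with h | ⟨V₀, hV₀⟩
    · simp [h]
    · rw [← measure_preimage_mul (orthogonalHaar d) (U * V₀⁻¹) good]
      refine measure_mono fun V hV i k hk => ?_
      have hd : ∀ l, |(V : Mat d) l k - (V₀ : Mat d) l k| ≤ 1 / K := fun l => by
        have : cell V = cell V₀ := hV.trans hV₀.symm
        have h2 := congrArg Fin.val (congrFun this (l, ⟨k, hk⟩))
        exact abs_sub_le_of_floor_eq hK (abs_le.mp (abs_entry_le_one V l k)).1
          (abs_le.mp (abs_entry_le_one V₀ l k)).1 h2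
      -- Left multiplication by U V₀⁻¹ carries V₀ to U and acts column by column, so closeness of
      -- the columns in J is preserved. Each entry sums d errors of size at most 1/K.
      have e : ((U * V₀⁻¹ * V : Matrix.orthogonalGroup (Fin d) ℝ) : Mat d) - (U : Mat d)
          = ((U * V₀⁻¹ : Matrix.orthogonalGroup (Fin d) ℝ) : Mat d) *
            ((V : Mat d) - (V₀ : Mat d)) := by
        rw [Matrix.mul_sub, ← Submonoid.coe_mul, ← Submonoid.coe_mul, inv_mul_cancel_right]
      rw [← Matrix.sub_apply, e, Matrix.mul_apply]
      calc _ ≤ ∑ l, |((U * V₀⁻¹ : Matrix.orthogonalGroup (Fin d) ℝ) : Mat d) i l *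
            ((V : Mat d) - (V₀ : Mat d)) l k| := Finset.abs_sum_le_sum_abs _ _
        _ ≤ ∑ _l : Fin d, 1 * (1 / (K : ℝ)) := by
            refine Finset.sum_le_sum fun l _ => ?_
            rw [abs_mul]
            exact mul_le_mul (abs_entry_le_one _ _ _) (hd l) (abs_nonneg _) zero_le_one
        _ = d / K := by simp [div_eq_mul_inv]
  have huniv : (1 : ℝ≥0∞) ≤ ((2 * K + 1 : ℕ) : ℝ≥0∞) ^ (d * J.card) * orthogonalHaar d good := by
    calc (1 : ℝ≥0∞) = orthogonalHaar d (⋃ c, cell ⁻¹' {c}) := by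
          rw [← Set.preimage_iUnion, Set.iUnion_of_singleton, Set.preimage_univ, measure_univ]
      _ ≤ ∑ c, orthogonalHaar d (cell ⁻¹' {c}) := measure_iUnion_fintype_le _ _
      _ ≤ ∑ _c : Fin d × J → Fin (2 * K + 1), orthogonalHaar d good :=
          Finset.sum_le_sum fun c _ => hfib c
      _ = _ := by
          rw [Finset.sum_const, nsmul_eq_mul, Finset.card_univ, Fintype.card_fun,
            Fintype.card_prod, Fintype.card_fin, Fintype.card_fin, Fintype.card_coe]
          push_cast
          rfl
  rw [ENNReal.inv_le_iff_le_mul (fun _ => pow_ne_zero _ (by simp))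
    (fun h => absurd h (ENNReal.pow_ne_top (ENNReal.natCast_ne_top _)))]
  exact huniv

/-- Convexity of Γ between Γ(1) = Γ(2) = 1 gives aΓ(a) = Γ(a + 1) ≤ 1. -/
lemma Gamma_le_inv {a : ℝ} (h0 : 0 < a) (h1 : a ≤ 1) : Real.Gamma a ≤ a⁻¹ := by
  have hc := Real.convexOn_Gamma.2 (Set.mem_Ioi.mpr one_pos) (Set.mem_Ioi.mpr two_pos)
    (sub_nonneg.mpr h1) h0.le (sub_add_cancel 1 a)
  have e : (1 - a) • (1 : ℝ) + a • (2 : ℝ) = a + 1 := by simp; ring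
  rw [e, Real.Gamma_add_one h0.ne', Real.Gamma_one, Real.Gamma_two] at hc
  rw [← one_div, le_div_iff₀ h0]
  simp at hc
  linarith

/-- A small-shape Gamma distribution charges short intervals in `[0, 2]`. -/
lemma le_gammaMeasure_Ioc {a x τ : ℝ} (h0 : 0 < a) (h1 : a ≤ 1) (hx : 0 ≤ x) (hxτ : x + τ ≤ 2) :
    ENNReal.ofReal (a * Real.exp (-2) / 2 * τ) ≤ gammaMeasure a 1 (Set.Ioc x (x + τ)) := by
  rw [gammaMeasure, withDensity_apply _ measurableSet_Ioc]
  calc ENNReal.ofReal (a * Real.exp (-2) / 2 * τ)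
      = ∫⁻ _ in Set.Ioc x (x + τ), ENNReal.ofReal (a * Real.exp (-2) / 2) := by
        rw [lintegral_const, Measure.restrict_apply_univ, Real.volume_Ioc, add_sub_cancel_left,
          ENNReal.ofReal_mul (by positivity)]
    _ ≤ _ := by
        refine setLIntegral_mono' measurableSet_Ioc fun y hy => ?_
        have hy0 : 0 < y := hx.trans_lt hy.1
        have hy2 : y ≤ 2 := hy.2.trans hxτ
        rw [gammaPDF_of_nonneg hy0.le]
        refine ENNReal.ofReal_le_ofReal ?_
        rw [Real.one_rpow, one_mul]
        have hG : a ≤ 1 / Real.Gamma a := by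
          rw [le_div_iff₀ (Real.Gamma_pos_of_pos h0)]
          have := mul_le_mul_of_nonneg_left (Gamma_le_inv h0 h1) h0.le
          rwa [mul_inv_cancel₀ h0.ne'] at this
        -- The exponent lies in (-1, 0], so the power is smallest at the right end y = 2, where it
        -- is at least 1/2.
        have hp : (1 : ℝ) / 2 ≤ y ^ (a - 1) := by
          calc (1 : ℝ) / 2 = 2 ^ (-1 : ℝ) := by rw [Real.rpow_neg_one]; norm_num
            _ ≤ 2 ^ (a - 1) := Real.rpow_le_rpow_of_exponent_le (by norm_num) (by linarith)
            _ ≤ y ^ (a - 1) := Real.rpow_le_rpow_of_nonpos hy0 hy2 (by linarith)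
        have he : Real.exp (-2) ≤ Real.exp (-y) := Real.exp_le_exp.mpr (by linarith)
        calc a * Real.exp (-2) / 2 = a * (1 / 2) * Real.exp (-2) := by ring
          _ ≤ _ := by gcongr

/-- The intervals are one-sided so that the normalising sum lies in [1, 1 + dτ]: division never
enlarges a coordinate, and shrinks γ i by at most dτ. -/
lemma abs_normalise_sub_le {d : ℕ} {g γ : Fin d → ℝ} {τ : ℝ} (hγ0 : ∀ i, 0 ≤ γ i)
    (hγ : ∑ i, γ i = 1) (hg : ∀ i, g i ∈ Set.Ioc (γ i) (γ i + τ)) (i : Fin d) :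
    |g i / ∑ k, g k - γ i| ≤ d * τ := by
  have hS1 : 1 ≤ ∑ k, g k := hγ ▸ Finset.sum_le_sum fun k _ => (hg k).1.le
  have hS2 : ∑ k, g k ≤ 1 + d * τ := by
    calc ∑ k, g k ≤ ∑ k, (γ k + τ) := Finset.sum_le_sum fun k _ => (hg k).2
      _ = 1 + d * τ := by simp [Finset.sum_add_distrib, hγ]
  have hτ : 0 < τ := by linarith [(hg i).1, (hg i).2]
  have hd : (1 : ℝ) ≤ d := by exact_mod_cast Fin.pos i
  have hγ1 : γ i ≤ 1 := hγ ▸ Finset.single_le_sum (fun k _ => hγ0 k) (Finset.mem_univ i)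
  set S := ∑ k, g k with hS
  have hS0 : 0 < S := by linarith
  have h1 := (hg i).1
  have h2 := (hg i).2
  have h3 := hγ0 i
  rw [abs_le, neg_le_sub_iff_le_add, sub_le_iff_le_add, div_le_iff₀ hS0, ← sub_le_iff_le_add,
    le_div_iff₀ hS0]
  constructor
  · nlinarith [mul_nonneg h3 (by linarith : 0 ≤ 1 - γ i), mul_nonneg hτ.le (by linarith : 0 ≤ (d : ℝ))]
  · have : τ ≤ d * τ := by nlinarith
    nlinarith

/-- Entrywise stability of `V diag(x) Vᵀ`. -/
lemma abs_conj_diagonal_sub_le {d : ℕ} (V U : Matrix.orthogonalGroup (Fin d) ℝ)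
    {x y : Fin d → ℝ} {s t : ℝ} (hs : ∀ k, |x k - y k| ≤ s) (hy : ∀ k, |y k| ≤ 1) (ht0 : 0 ≤ t)
    (ht : ∀ i, ∀ k, y k ≠ 0 → |(V : Mat d) i k - (U : Mat d) i k| ≤ t) (i j : Fin d) :
    |((V : Mat d) * Matrix.diagonal x * (V : Mat d).transpose) i j -
      ((U : Mat d) * Matrix.diagonal y * (U : Mat d).transpose) i j| ≤ d * (s + 2 * t) := by
  rw [Matrix.mul_apply, Matrix.mul_apply, ← Finset.sum_sub_distrib]
  refine (Finset.abs_sum_le_sum_abs _ _).trans ?_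
  calc _ ≤ ∑ _k : Fin d, (s + 2 * t) := by
        refine Finset.sum_le_sum fun k _ => ?_
        simp only [Matrix.mul_diagonal, Matrix.transpose_apply]
        set v := (V : Mat d) with hv
        set u := (U : Mat d) with hu
        have e : v i k * x k * v j k - u i k * y k * u j k =
            (x k - y k) * (v i k * v j k) + y k * ((v i k - u i k) * v j k + u i k * (v j k - u j k)) := by
          ring
        rw [e]
        refine (abs_add_le _ _).trans (add_le_add ?_ ?_)
        · rw [abs_mul, abs_mul]
          have h1 : |v i k| * |v j k| ≤ 1 :=
            mul_le_one₀ (abs_entry_le_one V i k) (abs_nonneg _) (abs_entry_le_one V j k)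
          calc |x k - y k| * (|v i k| * |v j k|) ≤ s * 1 :=
                mul_le_mul (hs k) h1 (by positivity) ((abs_nonneg _).trans (hs k))
            _ = s := mul_one s
        -- For `y k = 0` this summand vanishes whatever the k-th column of V is. This is why the
        -- Haar cost involves the rank and not d columns.
        · by_cases h0 : y k = 0
          · simp [h0, ht0]
          · rw [abs_mul]
            calc |y k| * |(v i k - u i k) * v j k + u i k * (v j k - u j k)|
                ≤ 1 * (t * 1 + 1 * t) := by
                  refine mul_le_mul (hy k) ((abs_add_le _ _).trans ?_) (abs_nonneg _) zero_le_one
                  rw [abs_mul, abs_mul]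
                  exact add_le_add
                    (mul_le_mul (ht i k h0) (abs_entry_le_one V j k) (abs_nonneg _) ht0)
                    (mul_le_mul (abs_entry_le_one U i k) (ht j k h0) (abs_nonneg _) zero_le_one)
              _ = 2 * t := by ring
    _ = d * (s + 2 * t) := by rw [Finset.sum_const, Finset.card_univ, Fintype.card_fin, nsmul_eq_mul]

lemma sum_sq_entries_conj_diagonal {d : ℕ} (V : Matrix.orthogonalGroup (Fin d) ℝ)
    (x : Fin d → ℝ) :
    ∑ i, ∑ j, ((V : Mat d) * Matrix.diagonal x * (V : Mat d).transpose) i j ^ 2 =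
      ∑ k, x k ^ 2 := by
  have hV : (V : Mat d).transpose * (V : Mat d) = 1 := by
    simpa [Matrix.star_eq_conjTranspose] using (Matrix.mem_orthogonalGroup_iff' (Fin d) ℝ).mp V.2
  set A := (V : Mat d) * Matrix.diagonal x * (V : Mat d).transpose with hA
  have h1 : ∑ i, ∑ j, A i j ^ 2 = (A * A.transpose).trace := by
    simp [Matrix.trace, Matrix.mul_apply, sq]
  rw [h1, hA, Matrix.transpose_mul, Matrix.transpose_mul, Matrix.transpose_transpose,
    Matrix.diagonal_transpose]
  have h2 : (V : Mat d) * Matrix.diagonal x * (V : Mat d).transpose *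
      ((V : Mat d) * (Matrix.diagonal x * (V : Mat d).transpose)) =
      (V : Mat d) * (Matrix.diagonal x * ((V : Mat d).transpose * (V : Mat d)) *
        Matrix.diagonal x * (V : Mat d).transpose) := by
    simp only [Matrix.mul_assoc]
  rw [h2, hV, Matrix.mul_one, Matrix.trace_mul_comm, Matrix.mul_assoc, hV, Matrix.mul_one,
    Matrix.diagonal_mul_diagonal, Matrix.trace_diagonal]
  simp [sq]

lemma conj_diagonal_mem_unitPSD {d : ℕ} (V : Matrix.orthogonalGroup (Fin d) ℝ)
    {x : Fin d → ℝ} (hx0 : ∀ k, 0 ≤ x k) (hx : ∑ k, x k ^ 2 = 1) :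
    (V : Mat d) * Matrix.diagonal x * (V : Mat d).transpose ∈ unitPSD d := by
  refine ⟨?_, by rw [sum_sq_entries_conj_diagonal, hx]⟩
  have := (Matrix.PosSemidef.diagonal (n := Fin d) (R := ℝ) (d := x) hx0).mul_mul_conjTranspose_same
    (V : Mat d)
  simpa using this

lemma exists_conj_diagonal_of_mem_unitPSD {d : ℕ} {B : Mat d} (hB : B ∈ unitPSD d) :
    ∃ (U : Matrix.orthogonalGroup (Fin d) ℝ) (y : Fin d → ℝ), (∀ k, 0 ≤ y k) ∧
      ∑ k, y k ^ 2 = 1 ∧ B = (U : Mat d) * Matrix.diagonal y * (U : Mat d).transpose ∧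
      (Finset.univ.filter fun k => y k ≠ 0).card = B.rank := by
  have hH := hB.1.isHermitian
  have hsp : B = (hH.eigenvectorUnitary : Mat d) * Matrix.diagonal hH.eigenvalues *
      (hH.eigenvectorUnitary : Mat d).transpose := by
    have := hH.spectral_theorem
    rw [Unitary.conjStarAlgAut_apply] at this
    simpa [Function.comp_def, Matrix.star_eq_conjTranspose] using this
  refine ⟨hH.eigenvectorUnitary, hH.eigenvalues, hB.1.eigenvalues_nonneg, ?_, hsp, ?_⟩
  · have h := hB.2
    rw [hsp, sum_sq_entries_conj_diagonal hH.eigenvectorUnitary] at h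
    exact h
  · rw [hH.rank_eq_card_non_zero_eigs, Fintype.card_subtype]

lemma measurable_conj_diagonal (d : ℕ) :
    Measurable fun p : Matrix.orthogonalGroup (Fin d) ℝ × (Fin d → ℝ) =>
      (p.1 : Mat d) * Matrix.diagonal (fun i => √(p.2 i)) * (p.1 : Mat d).transpose := by
  refine Continuous.measurable ?_
  fun_prop

lemma measurableSet_unitPSD (d : ℕ) : MeasurableSet (unitPSD d) := by
  have e : unitPSD d = {B : Mat d | B.conjTranspose = B} ∩
      (⋂ x : Fin d → ℝ, {B : Mat d | 0 ≤ star x ⬝ᵥ B.mulVec x}) ∩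
      {B : Mat d | ∑ i, ∑ j, B i j ^ 2 = 1} := by
    ext B
    simp [unitPSD, Matrix.posSemidef_iff_dotProduct_mulVec, Matrix.IsHermitian]
  rw [e]
  -- The positivity conditions are uncountably many, but each is closed, so their intersection is
  -- closed and hence measurable.
  refine ((IsClosed.inter ?_ (isClosed_iInter fun x => ?_)).inter ?_).measurableSet
  · exact isClosed_eq (by fun_prop) continuous_id
  · exact isClosed_le continuous_const (by fun_prop)
  · exact isClosed_eq (by fun_prop) continuous_const

lemma measurable_normalise (d : ℕ) :
    Measurable fun (g : Fin d → ℝ) (i : Fin d) => g i / ∑ k, g k := by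
  fun_prop

lemma ae_gammaMeasure_pos (a : ℝ) : ∀ᵐ x ∂gammaMeasure a 1, 0 < x := by
  have hs : MeasurableSet (Set.Iic (0 : ℝ)) := measurableSet_Iic
  rw [ae_iff]
  have : {x : ℝ | ¬ 0 < x} = Set.Iic 0 := by ext; simp
  rw [this, gammaMeasure, withDensity_apply _ hs, setLIntegral_congr Iio_ae_eq_Iic.symm,
    setLIntegral_congr_fun measurableSet_Iio (fun x (hx : x < 0) => gammaPDF_of_neg hx),
    lintegral_zero]

section MatrixPrior

variable {d : ℕ} {α : Fin d → ℝ}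

lemma isProbabilityMeasure_dirichlet (hα : ∀ i, 0 < α i) :
    IsProbabilityMeasure (dirichlet α) := by
  have : ∀ i, IsProbabilityMeasure (gammaMeasure (α i) 1) := fun i =>
    isProbabilityMeasure_gammaMeasure (hα i) one_pos
  exact Measure.isProbabilityMeasure_map (measurable_normalise d).aemeasurable

lemma ae_dirichlet (hd : 1 ≤ d) (hα : ∀ i, 0 < α i) :
    ∀ᵐ γ ∂dirichlet α, (∀ i, 0 ≤ γ i) ∧ ∑ i, γ i = 1 := by
  have : ∀ i, IsProbabilityMeasure (gammaMeasure (α i) 1) := fun i =>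
    isProbabilityMeasure_gammaMeasure (hα i) one_pos
  have hms : MeasurableSet {γ : Fin d → ℝ | (∀ i, 0 ≤ γ i) ∧ ∑ i, γ i = 1} := by
    measurability
  rw [dirichlet, ae_map_iff (measurable_normalise d).aemeasurable hms]
  have h : ∀ᵐ g ∂Measure.pi fun i => gammaMeasure (α i) 1, ∀ i, 0 < g i := by
    rw [ae_all_iff]
    intro i
    exact (Measure.tendsto_eval_ae_ae (μ := fun i => gammaMeasure (α i) 1) (i := i)).eventually
      (ae_gammaMeasure_pos (α i))
  filter_upwards [h] with g hg
  have : NeZero d := ⟨by omega⟩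
  have hS : 0 < ∑ k, g k := Finset.sum_pos (fun k _ => hg k) Finset.univ_nonempty
  exact ⟨fun i => div_nonneg (hg i).le hS.le, by rw [← Finset.sum_div, div_self hS.ne']⟩

lemma isProbabilityMeasure_matrixPrior (hα : ∀ i, 0 < α i) :
    IsProbabilityMeasure (matrixPrior α) := by
  have := isProbabilityMeasure_dirichlet hα
  exact Measure.isProbabilityMeasure_map (measurable_conj_diagonal d).aemeasurable

lemma ae_matrixPrior_mem_unitPSD (hd : 1 ≤ d) (hα : ∀ i, 0 < α i) :
    ∀ᵐ B ∂matrixPrior α, B ∈ unitPSD d := by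
  have := isProbabilityMeasure_dirichlet hα
  refine (ae_map_iff (β := Mat d) (p := fun B => B ∈ unitPSD d)
    (measurable_conj_diagonal d).aemeasurable (measurableSet_unitPSD d)).mpr ?_
  have h := Measure.quasiMeasurePreserving_snd (μ := orthogonalHaar d) (ν := dirichlet α)
    |>.ae (ae_dirichlet hd hα)
  filter_upwards [h] with p hp
  refine conj_diagonal_mem_unitPSD p.1 (fun k => Real.sqrt_nonneg _) ?_
  rw [← hp.2]
  exact Finset.sum_congr rfl fun k _ => Real.sq_sqrt (hp.1 k)

/-- Independent Gamma variables just to the right of the γ i normalise to a point within dτ of γ.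
The bounds D₁/d ≤ α i ≤ 1 make every factor of the product at least a multiple of τ/d. -/
lemma le_dirichlet {D₁ τ : ℝ} (hD₁ : 0 < D₁) (hα1 : ∑ i, α i = 1) (hα : ∀ i, D₁ / d ≤ α i)
    (hτ0 : 0 < τ) (hτ1 : τ ≤ 1) {γ : Fin d → ℝ} (hγ0 : ∀ i, 0 ≤ γ i) (hγ : ∑ i, γ i = 1) :
    ENNReal.ofReal ((D₁ / d * Real.exp (-2) / 2 * τ) ^ d) ≤
      dirichlet α {x | ∀ i, |x i - γ i| ≤ d * τ} := by
  have hαpos : ∀ i, 0 < α i := fun i => by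
    have : (0 : ℝ) < d := by exact_mod_cast (Fin.pos i)
    exact (by positivity : 0 < D₁ / d).trans_le (hα i)
  have : ∀ i, IsProbabilityMeasure (gammaMeasure (α i) 1) := fun i =>
    isProbabilityMeasure_gammaMeasure (hαpos i) one_pos
  calc ENNReal.ofReal ((D₁ / d * Real.exp (-2) / 2 * τ) ^ d)
      = ∏ _i : Fin d, ENNReal.ofReal (D₁ / d * Real.exp (-2) / 2 * τ) := by
        rw [Finset.prod_const, Finset.card_univ, Fintype.card_fin,
          ENNReal.ofReal_pow (by positivity)]
    _ ≤ ∏ i, gammaMeasure (α i) 1 (Set.Ioc (γ i) (γ i + τ)) := by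
        refine Finset.prod_le_prod' fun i _ => ?_
        have hα1' : α i ≤ 1 := hα1 ▸ Finset.single_le_sum (fun k _ => (hαpos k).le)
          (Finset.mem_univ i)
        have hγ1 : γ i ≤ 1 := hγ ▸ Finset.single_le_sum (fun k _ => hγ0 k) (Finset.mem_univ i)
        refine le_trans (ENNReal.ofReal_le_ofReal ?_)
          (le_gammaMeasure_Ioc (hαpos i) hα1' (hγ0 i) (by linarith))
        have := hα i
        gcongr
    _ = Measure.pi (fun i => gammaMeasure (α i) 1)
          (Set.univ.pi fun i => Set.Ioc (γ i) (γ i + τ)) := (Measure.pi_pi _ _).symm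
    _ ≤ Measure.pi (fun i => gammaMeasure (α i) 1)
          ((fun (g : Fin d → ℝ) (i : Fin d) => g i / ∑ k, g k) ⁻¹'
            {x | ∀ i, |x i - γ i| ≤ d * τ}) := by
        refine measure_mono fun g hg i => ?_
        exact abs_normalise_sub_le hγ0 hγ (fun i => hg i (Set.mem_univ i)) i
    _ ≤ _ := Measure.le_map_apply (measurable_normalise d).aemeasurable _

/-- Eigenvalues are square roots of Dirichlet coordinates, and near 0 the root is only Hölder of
order 1/2; hence the √(dτ) in the radius of `le_matrixPrior`. -/
lemma abs_sqrt_sub_sqrt_le (a b : ℝ) : |√a - √b| ≤ √|a - b| := by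
  have key : ∀ x y : ℝ, √x ≤ √y + √|x - y| := fun x y => by
    rw [Real.sqrt_le_iff]
    refine ⟨by positivity, ?_⟩
    have h1 : y ≤ √y ^ 2 := by
      rcases le_total 0 y with h | h
      · rw [Real.sq_sqrt h]
      · exact h.trans (sq_nonneg _)
    have h2 := Real.sq_sqrt (abs_nonneg (x - y))
    nlinarith [le_abs_self (x - y), Real.sqrt_nonneg y, Real.sqrt_nonneg |x - y|,
      mul_nonneg (Real.sqrt_nonneg y) (Real.sqrt_nonneg |x - y|)]
  rw [abs_sub_le_iff]
  have h2 := key b a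
  rw [abs_sub_comm b a] at h2
  constructor <;> linarith [key a b]

/-- The prior on matrices charges small neighbourhoods of a low-rank matrix. -/
theorem le_matrixPrior {D₁ τ : ℝ} (hD₁ : 0 < D₁) (hα1 : ∑ i, α i = 1)
    (hα : ∀ i, D₁ / d ≤ α i) (hτ0 : 0 < τ) (hτ1 : τ ≤ 1) {K : ℕ} (hK : 0 < K) {B : Mat d}
    (hB : B ∈ unitPSD d) :
    ENNReal.ofReal ((((2 * K + 1 : ℕ) : ℝ) ^ (d * B.rank))⁻¹ *
        (D₁ / d * Real.exp (-2) / 2 * τ) ^ d) ≤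
      matrixPrior α {B' | ∀ i j, |B' i j - B i j| ≤ d * (√(d * τ) + 2 * (d / K))} := by
  obtain ⟨U, y, hy0, hy1, hBU, hcard⟩ := exists_conj_diagonal_of_mem_unitPSD hB
  have hαpos : ∀ i, 0 < α i := fun i => by
    have : (0 : ℝ) < d := by exact_mod_cast (Fin.pos i)
    exact (by positivity : 0 < D₁ / d).trans_le (hα i)
  have := isProbabilityMeasure_dirichlet hαpos
  -- Only the columns belonging to nonzero eigenvalues are matched; their number is the rank.
  have h1 := le_orthogonalHaar_columns U (Finset.univ.filter fun k => y k ≠ 0) hK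
  have h2 := le_dirichlet hD₁ hα1 hα hτ0 hτ1 (fun i => sq_nonneg (y i)) hy1
  rw [hcard] at h1
  rw [ENNReal.ofReal_mul (by positivity), ENNReal.ofReal_inv_of_pos (by positivity),
    ENNReal.ofReal_pow (by positivity), ENNReal.ofReal_natCast]
  refine (mul_le_mul' h1 h2).trans ?_
  rw [← Measure.prod_prod]
  refine le_trans (measure_mono ?_)
    (Measure.le_map_apply (measurable_conj_diagonal d).aemeasurable _)
  rintro ⟨V, γ⟩ ⟨hV, hγ⟩ i j
  rw [hBU]
  refine abs_conj_diagonal_sub_le V U (fun k => ?_) (fun k => ?_) (by positivity)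
    (fun i k hk => hV i k (by simp [hk])) i j
  · have h3 := abs_sqrt_sub_sqrt_le (γ k) (y k ^ 2)
    rw [Real.sqrt_sq (hy0 k)] at h3
    exact h3.trans (Real.sqrt_le_sqrt (hγ k))
  · rw [abs_of_nonneg (hy0 k)]
    have : y k ^ 2 ≤ 1 := hy1 ▸ Finset.single_le_sum (f := fun k => y k ^ 2)
      (fun k _ => sq_nonneg (y k)) (Finset.mem_univ k)
    nlinarith [hy0 k]

end MatrixPrior


/-! ### Small-ball bounds for the prior on coefficients. -/

/-- The weighted `ℓ¹` norm `∑ j |β j|` of a coefficient vector. -/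
def weightedNorm {M : ℕ} (β : Fin M → ℝ) : ℝ := ∑ j : Fin M, ((j : ℝ) + 1) * |β j|

lemma measurable_weightedNorm (M : ℕ) : Measurable (weightedNorm (M := M)) := by
  unfold weightedNorm
  fun_prop

lemma continuous_weightedNorm (M : ℕ) : Continuous (weightedNorm (M := M)) := by
  unfold weightedNorm
  fun_prop

lemma weightedNorm_smul {M : ℕ} (c : ℝ) (β : Fin M → ℝ) :
    weightedNorm (c • β) = |c| * weightedNorm β := by
  simp only [weightedNorm, Finset.mul_sum, Pi.smul_apply, smul_eq_mul, abs_mul]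
  exact Finset.sum_congr rfl fun j _ => by ring

lemma weightedNorm_add_le {M : ℕ} (β γ : Fin M → ℝ) :
    weightedNorm (β + γ) ≤ weightedNorm β + weightedNorm γ := by
  simp only [weightedNorm, ← Finset.sum_add_distrib, ← mul_add]
  exact Finset.sum_le_sum fun j _ => mul_le_mul_of_nonneg_left (abs_add_le _ _) (by positivity)

lemma sum_abs_le_weightedNorm {M : ℕ} (β : Fin M → ℝ) : ∑ j, |β j| ≤ weightedNorm β :=
  Finset.sum_le_sum fun j _ => by
    have : (0 : ℝ) ≤ (j : ℝ) := by positivity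
    nlinarith [abs_nonneg (β j)]

section Volume

variable {M : ℕ}

/-- Translation and scaling of Lebesgue measure. The volume of the unit ball is never computed,
since it cancels in the uniform law. -/
lemma volume_weightedNorm_sub_le (β₀ : Fin M → ℝ) {R : ℝ} (hR : 0 < R) :
    volume {β : Fin M → ℝ | weightedNorm (β - β₀) ≤ R} =
      ENNReal.ofReal (R ^ M) * volume {β : Fin M → ℝ | weightedNorm β ≤ 1} := by
  have e : {β : Fin M → ℝ | weightedNorm (β - β₀) ≤ R} =
      (fun β => β + -β₀) ⁻¹' ((fun β => R⁻¹ • β) ⁻¹' {β : Fin M → ℝ | weightedNorm β ≤ 1}) := by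
    ext β
    simp only [Set.mem_ofPred_eq, Set.mem_preimage, weightedNorm_smul, abs_inv, abs_of_pos hR,
      ← sub_eq_add_neg]
    rw [inv_mul_le_iff₀ hR, mul_one]
  rw [e, measure_preimage_add_right, Measure.addHaar_preimage_smul _ (inv_ne_zero hR.ne')]
  congr 2
  rw [Module.finrank_fin_fun, inv_pow, inv_inv, abs_of_pos (by positivity)]

lemma volume_weightedNorm_le_one_ne_zero :
    volume {β : Fin M → ℝ | weightedNorm β ≤ 1} ≠ 0 := by
  have ho : IsOpen {β : Fin M → ℝ | weightedNorm β < 1} :=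
    isOpen_lt (continuous_weightedNorm M) continuous_const
  have hne : {β : Fin M → ℝ | weightedNorm β < 1}.Nonempty := ⟨0, by simp [weightedNorm]⟩
  refine ne_of_gt ((ho.measure_pos volume hne).trans_le (measure_mono fun β hβ => ?_))
  exact (show weightedNorm β < 1 from hβ).le

lemma volume_weightedNorm_le_one_ne_top :
    volume {β : Fin M → ℝ | weightedNorm β ≤ 1} ≠ ∞ := by
  refine ((measure_mono (t := Set.Icc (fun _ => -1) (fun _ => 1)) fun β hβ => ?_).trans_lt
    isCompact_Icc.measure_lt_top).ne
  have h : ∀ j, |β j| ≤ 1 := fun j =>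
    ((Finset.single_le_sum (f := fun j => |β j|) (fun j _ => abs_nonneg _)
      (Finset.mem_univ j)).trans (sum_abs_le_weightedNorm β)).trans hβ
  exact ⟨fun j => (abs_le.mp (h j)).1, fun j => (abs_le.mp (h j)).2⟩

lemma coefBall_eq (M : ℕ) (Λ : ℝ) :
    coefBall M Λ = {β | weightedNorm β ≤ Λ} ∩ {β | ∀ j : Fin M, (j : ℕ) + 1 = M → β j ≠ 0} := rfl

lemma measurableSet_coefBall (M : ℕ) (Λ : ℝ) : MeasurableSet (coefBall M Λ) := by
  rw [coefBall_eq]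
  refine (measurableSet_le (measurable_weightedNorm M) measurable_const).inter ?_
  have e : {β : Fin M → ℝ | ∀ j : Fin M, (j : ℕ) + 1 = M → β j ≠ 0} =
      ⋂ j : Fin M, ⋂ _ : (j : ℕ) + 1 = M, {β : Fin M → ℝ | β j = 0}ᶜ := by
    ext β
    simp
  rw [e]
  exact MeasurableSet.iInter fun j => MeasurableSet.iInter fun _ =>
    (measurableSet_eq_fun (measurable_pi_apply j) measurable_const).compl

lemma ae_last_ne_zero (M : ℕ) :
    ∀ᵐ β : Fin M → ℝ, ∀ j : Fin M, (j : ℕ) + 1 = M → β j ≠ 0 := by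
  rw [ae_all_iff]
  intro j
  have h : volume {β : Fin M → ℝ | β j = 0} = 0 :=
    Measure.pi_hyperplane (fun _ : Fin M => (volume : Measure ℝ)) j 0
  have h2 : ∀ᵐ β : Fin M → ℝ, β j ≠ 0 := by
    rw [ae_iff]
    simpa using h
  filter_upwards [h2] with β hβ _ using hβ

/-- The condition on the last coefficient removes only a hyperplane, so volumes are those of the
full ball. -/
lemma volume_inter_coefBall (Λ : ℝ) (s : Set (Fin M → ℝ)) :
    volume (coefBall M Λ ∩ s) = volume ({β : Fin M → ℝ | weightedNorm β ≤ Λ} ∩ s) := by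
  refine measure_congr ?_
  filter_upwards [ae_last_ne_zero M] with β hβ
  have : (β ∈ coefBall M Λ ∩ s) = (β ∈ {β : Fin M → ℝ | weightedNorm β ≤ Λ} ∩ s) := by
    rw [coefBall_eq]
    simp only [Set.mem_inter_iff, Set.mem_ofPred_eq, eq_iff_iff]
    tauto
  exact this

lemma volume_coefBall {Λ : ℝ} (hΛ : 0 < Λ) :
    volume (coefBall M Λ) =
      ENNReal.ofReal (Λ ^ M) * volume {β : Fin M → ℝ | weightedNorm β ≤ 1} := by
  have h := volume_inter_coefBall (M := M) Λ Set.univ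
  rw [Set.inter_univ, Set.inter_univ] at h
  rw [h, ← volume_weightedNorm_sub_le 0 hΛ]
  simp

lemma isProbabilityMeasure_cond_coefBall {Λ : ℝ} (hΛ : 0 < Λ) :
    IsProbabilityMeasure (cond (volume : Measure (Fin M → ℝ)) (coefBall M Λ)) := by
  refine cond_isProbabilityMeasure_of_finite ?_ ?_ <;> rw [volume_coefBall hΛ]
  · exact mul_ne_zero (by simpa using pow_pos hΛ M) volume_weightedNorm_le_one_ne_zero
  · exact ENNReal.mul_ne_top ENNReal.ofReal_ne_top volume_weightedNorm_le_one_ne_top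

/-- The uniform law on a larger ball charges small neighbourhoods of a point of a smaller one. -/
lemma le_cond_coefBall {C τ : ℝ} (hC : 0 ≤ C) (hτ0 : 0 < τ) (hτ1 : τ ≤ 1) {β₀ : Fin M → ℝ}
    (hβ₀ : weightedNorm β₀ ≤ C) :
    ENNReal.ofReal ((τ / (C + 1)) ^ M) ≤ cond (volume : Measure (Fin M → ℝ)) (coefBall M (C + 1))
      {β | weightedNorm (β - β₀) ≤ τ} := by
  have hC1 : 0 < C + 1 := by linarith
  rw [cond_apply (measurableSet_coefBall _ _), volume_inter_coefBall, volume_coefBall hC1]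
  -- The prior ball has radius C + 1 while competitors have norm at most C: the margin 1 ≥ τ keeps
  -- the whole small ball inside.
  have e : {β : Fin M → ℝ | weightedNorm β ≤ C + 1} ∩ {β | weightedNorm (β - β₀) ≤ τ} =
      {β | weightedNorm (β - β₀) ≤ τ} := by
    refine Set.inter_eq_right.mpr fun β hβ => ?_
    have h := weightedNorm_add_le (β - β₀) β₀
    rw [sub_add_cancel] at h
    have hβ' : weightedNorm (β - β₀) ≤ τ := hβ
    exact h.trans (by linarith)
  rw [e, volume_weightedNorm_sub_le β₀ hτ0]
  have hn0 := volume_weightedNorm_le_one_ne_zero (M := M)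
  have hnt := volume_weightedNorm_le_one_ne_top (M := M)
  rw [ENNReal.mul_inv (Or.inr hnt) (Or.inr hn0)]
  set v := volume {β : Fin M → ℝ | weightedNorm β ≤ 1}
  calc ENNReal.ofReal ((τ / (C + 1)) ^ M)
      = (ENNReal.ofReal ((C + 1) ^ M))⁻¹ * ENNReal.ofReal (τ ^ M) * (v⁻¹ * v) := by
        rw [ENNReal.inv_mul_cancel hn0 hnt, mul_one, ← ENNReal.ofReal_inv_of_pos (by positivity),
          ← ENNReal.ofReal_mul (by positivity), div_pow, div_eq_inv_mul]
    _ ≤ _ := le_of_eq (by ring)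

end Volume

section LinkPrior

lemma measurable_pad (M n : ℕ) : Measurable (pad M n) := by
  refine measurable_pi_iff.mpr fun j => ?_
  unfold pad
  split_ifs <;> fun_prop

/-- Terms vanishing at a zero coefficient do not see the padding; both the weighted norm and the
link function are sums of this kind. -/
lemma sum_pad {M n : ℕ} (hMn : M ≤ n) (β : Fin M → ℝ) (F : ℕ → ℝ → ℝ) (hF : ∀ j, F j 0 = 0) :
    ∑ j : Fin n, F j (pad M n β j) = ∑ j : Fin M, F j (β j) := by
  have h1 : ∑ j : Fin n, F j (pad M n β j) =
      ∑ j ∈ Finset.range n, F j (if h : j < M then β ⟨j, h⟩ else 0) := by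
    rw [Finset.sum_range]
    rfl
  have h2 : ∑ j : Fin M, F j (β j) =
      ∑ j ∈ Finset.range M, F j (if h : j < M then β ⟨j, h⟩ else 0) := by
    rw [Finset.sum_range]
    exact Finset.sum_congr rfl fun j _ => by simp
  rw [h1, h2]
  symm
  refine Finset.sum_subset (fun j hj => ?_) fun j _ hj => ?_
  · simp only [Finset.mem_range] at *
    omega
  · rw [dif_neg (by simpa using hj), hF]

lemma weightedNorm_pad {M n : ℕ} (hMn : M ≤ n) (β : Fin M → ℝ) :
    weightedNorm (pad M n β) = weightedNorm β :=
  sum_pad hMn β (fun j x => ((j : ℝ) + 1) * |x|) (by simp)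

lemma link_pad {M n : ℕ} (hMn : M ≤ n) (φ : ℕ → ℝ → ℝ) (β : Fin M → ℝ) :
    link φ (pad M n β) = link φ β := by
  ext t
  exact sum_pad hMn β (fun j x => x * φ (j + 1) t) (by simp)

lemma pad_sub (M n : ℕ) (β γ : Fin M → ℝ) : pad M n (β - γ) = pad M n β - pad M n γ := by
  ext j
  simp only [pad, Pi.sub_apply]
  split_ifs <;> simp

lemma sum_link_weights {n : ℕ} (hn : 1 ≤ n) :
    ∑ M ∈ Finset.Icc 1 n, 9 / (1 - (1 / 10 : ℝ) ^ n) * (1 / 10 : ℝ) ^ M = 1 := by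
  have h1 : ((1 : ℝ) / 10) ^ n < 1 := pow_lt_one₀ (by norm_num) (by norm_num) (by omega)
  have h2 : ∑ M ∈ Finset.Icc 1 n, (1 / 10 : ℝ) ^ M = (1 - (1 / 10 : ℝ) ^ n) / 9 := by
    clear h1 hn
    induction n with
    | zero => simp
    | succ n ih =>
      rw [Finset.sum_Icc_succ_top (by omega), ih, pow_succ]
      ring
  rw [← Finset.mul_sum, h2]
  field_simp
  exact div_self (by linarith)

variable {n : ℕ} {C : ℝ}

lemma isProbabilityMeasure_linkPrior (hn : 1 ≤ n) (hC : 0 ≤ C) :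
    IsProbabilityMeasure (linkPrior n C) := by
  have h1 : ((1 : ℝ) / 10) ^ n < 1 := pow_lt_one₀ (by norm_num) (by norm_num) (by omega)
  constructor
  rw [linkPrior, Measure.finsetSum_apply]
  calc _ = ∑ M ∈ Finset.Icc 1 n,
        ENNReal.ofReal (9 / (1 - (1 / 10 : ℝ) ^ n) * (1 / 10 : ℝ) ^ M) := by
        refine Finset.sum_congr rfl fun M _ => ?_
        have := isProbabilityMeasure_cond_coefBall (M := M) (Λ := C + 1) (by linarith)
        rw [Measure.smul_apply, Measure.map_apply (measurable_pad M n) MeasurableSet.univ]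
        simp
    _ = 1 := by
        rw [← ENNReal.ofReal_sum_of_nonneg, sum_link_weights hn, ENNReal.ofReal_one]
        intro M _
        have : 0 < 1 - ((1 : ℝ) / 10) ^ n := by linarith
        positivity

lemma ae_linkPrior_weightedNorm_le : ∀ᵐ b ∂linkPrior n C, weightedNorm b ≤ C + 1 := by
  have hms : MeasurableSet {b : Fin n → ℝ | ¬ weightedNorm b ≤ C + 1} :=
    (measurableSet_le (measurable_weightedNorm n) measurable_const).compl
  rw [ae_iff, linkPrior, Measure.finsetSum_apply]
  refine Finset.sum_eq_zero fun M hM => ?_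
  have hMn : M ≤ n := (Finset.mem_Icc.mp hM).2
  rw [Measure.smul_apply, Measure.map_apply (measurable_pad M n) hms,
    cond_apply (measurableSet_coefBall _ _)]
  have : coefBall M (C + 1) ∩ pad M n ⁻¹' {b : Fin n → ℝ | ¬ weightedNorm b ≤ C + 1} = ∅ := by
    ext β
    simp only [Set.mem_inter_iff, Set.mem_preimage, Set.mem_ofPred_eq, weightedNorm_pad hMn,
      Set.mem_empty_iff_false, iff_false, not_and, not_not]
    exact fun h => h.1
  rw [this]
  simp

/-- The prior on links charges small neighbourhoods of a vector with few coefficients. -/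
theorem le_linkPrior {M : ℕ} (hM : 1 ≤ M) (hMn : M ≤ n) (hC : 0 ≤ C) {τ : ℝ} (hτ0 : 0 < τ)
    (hτ1 : τ ≤ 1) {β₀ : Fin M → ℝ} (hβ₀ : weightedNorm β₀ ≤ C) :
    ENNReal.ofReal ((1 / 10 * (τ / (C + 1))) ^ M) ≤
      linkPrior n C {b | weightedNorm (b - pad M n β₀) ≤ τ} := by
  have h1 : ((1 : ℝ) / 10) ^ n < 1 := pow_lt_one₀ (by norm_num) (by norm_num) (by omega)
  have h2 : (0 : ℝ) < 1 - ((1 : ℝ) / 10) ^ n := by linarith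
  have h3 : (0 : ℝ) < ((1 : ℝ) / 10) ^ n := by positivity
  have hms : MeasurableSet {b : Fin n → ℝ | weightedNorm (b - pad M n β₀) ≤ τ} :=
    measurableSet_le ((measurable_weightedNorm n).comp (measurable_id.sub_const _))
      measurable_const
  rw [linkPrior, Measure.finsetSum_apply]
  -- Of the mixture only the component with the competitor's own M is kept.
  refine le_trans ?_ (Finset.single_le_sum (fun _ _ => zero_le)
    (Finset.mem_Icc.mpr ⟨hM, hMn⟩))
  rw [Measure.smul_apply, Measure.map_apply (measurable_pad M n) hms, mul_pow,
    ENNReal.ofReal_mul (by positivity), smul_eq_mul]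
  refine mul_le_mul' (ENNReal.ofReal_le_ofReal ?_) ?_
  -- The normalising factor is at least 1, so the weight is at least 10^(-M).
  · refine le_mul_of_one_le_left (by positivity) ?_
    rw [one_le_div h2]
    linarith
  · refine (le_cond_coefBall hC hτ0 hτ1 hβ₀).trans (measure_mono fun β hβ => ?_)
    simp only [Set.mem_preimage, Set.mem_ofPred_eq]
    rw [← pad_sub, weightedNorm_pad hMn]
    exact hβ

end LinkPrior


/-! ### The regression model: excess risk, its exponential moments and its stability. -/

lemma abs_pairing_sub_le {d : ℕ} {X B B' : Mat d} {s : ℝ} (hX : ∀ i j, |X i j| ≤ 1)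
    (hB : ∀ i j, |B' i j - B i j| ≤ s) : |pairing X B' - pairing X B| ≤ d ^ 2 * s := by
  have e : pairing X B' - pairing X B = ∑ i, ∑ j, X i j * (B' j i - B j i) := by
    simp [pairing, Matrix.trace, Matrix.mul_apply, mul_sub, Finset.sum_sub_distrib]
  rw [e]
  refine (Finset.abs_sum_le_sum_abs _ _).trans ?_
  calc _ ≤ ∑ _i : Fin d, ∑ _j : Fin d, s := by
        refine Finset.sum_le_sum fun i _ => (Finset.abs_sum_le_sum_abs _ _).trans
          (Finset.sum_le_sum fun j _ => ?_)
        rw [abs_mul]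
        have h1 := hX i j
        have h2 := hB j i
        nlinarith [abs_nonneg (X i j), abs_nonneg (B' j i - B j i)]
    _ = d ^ 2 * s := by simp; ring

lemma measurable_pairing (d : ℕ) : Measurable fun p : Mat d × Mat d => pairing p.1 p.2 := by
  refine Continuous.measurable ?_
  unfold pairing
  fun_prop

@[fun_prop]
lemma measurable_pairing_comp {d : ℕ} {T : Type*} [MeasurableSpace T] {X A : T → Mat d}
    (hX : Measurable X) (hA : Measurable A) : Measurable fun x => pairing (X x) (A x) :=
  (measurable_pairing d).comp (hX.prodMk hA)

section Dictionary

variable {φ : ℕ → ℝ → ℝ} {I : Set ℝ} {Cφ : ℝ} {n : ℕ}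


lemma IsDictionary.measurable_link (hφ : IsDictionary φ I Cφ) (b : Fin n → ℝ) : Measurable (link φ b) := by
  unfold link
  exact Finset.measurable_sum _ fun j _ => (hφ.measurable _ (by omega)).const_mul _

lemma IsDictionary.measurable_uncurry_link (hφ : IsDictionary φ I Cφ) :
    Measurable fun p : (Fin n → ℝ) × ℝ => link φ p.1 p.2 := by
  unfold link
  exact Finset.measurable_sum _ fun j _ =>
    ((measurable_pi_apply j).comp measurable_fst).mul
      ((hφ.measurable _ (by omega)).comp measurable_snd)

lemma IsDictionary.abs_link_le (hφ : IsDictionary φ I Cφ) (b : Fin n → ℝ) {t : ℝ} (ht : t ∈ I) :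
    |link φ b t| ≤ weightedNorm b := by
  refine (Finset.abs_sum_le_sum_abs _ _).trans (le_trans ?_ (sum_abs_le_weightedNorm b))
  refine Finset.sum_le_sum fun j _ => ?_
  rw [abs_mul]
  exact mul_le_of_le_one_right (abs_nonneg _) (hφ.abs_le_one _ (by omega) t ht)

/-- The weight j in the norm matches the Lipschitz constant j·Cφ of the j-th dictionary function, so
the constant does not grow with the number of terms. -/
lemma IsDictionary.abs_link_sub_le (hφ : IsDictionary φ I Cφ) (hI : I.OrdConnected) (b : Fin n → ℝ) {s t : ℝ} (hs : s ∈ I)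
    (ht : t ∈ I) : |link φ b s - link φ b t| ≤ weightedNorm b * Cφ * |s - t| := by
  have e : link φ b s - link φ b t =
      ∑ j : Fin n, b j * (φ ((j : ℕ) + 1) s - φ ((j : ℕ) + 1) t) := by
    simp [link, mul_sub, Finset.sum_sub_distrib]
  rw [e, weightedNorm, Finset.sum_mul, Finset.sum_mul]
  refine (Finset.abs_sum_le_sum_abs _ _).trans (Finset.sum_le_sum fun j _ => ?_)
  rw [abs_mul]
  have h := hI.convex.norm_image_sub_le_of_norm_derivWithin_le
    (hφ.differentiableOn ((j : ℕ) + 1) (by omega))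
    (fun x hx => hφ.abs_deriv_le ((j : ℕ) + 1) (by omega) x hx) ht hs
  rw [Real.norm_eq_abs, Real.norm_eq_abs] at h
  push_cast at h
  calc |b j| * |φ ((j : ℕ) + 1) s - φ ((j : ℕ) + 1) t|
      ≤ |b j| * (((j : ℝ) + 1) * Cφ * |s - t|) := mul_le_mul_of_nonneg_left h (abs_nonneg _)
    _ = _ := by ring

lemma link_sub (b b' : Fin n → ℝ) (t : ℝ) : link φ (b - b') t = link φ b t - link φ b' t := by
  simp [link, sub_mul, Finset.sum_sub_distrib]

end Dictionary

/-- The difference between a candidate regression function and the true one. -/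
def regressionGap {d n : ℕ} (φ : ℕ → ℝ → ℝ) (Bs : Mat d) (fs : ℝ → ℝ)
    (θ : Mat d × (Fin n → ℝ)) (z : Mat d × ℝ) : ℝ :=
  link φ θ.2 (pairing z.1 θ.1) - fs (pairing z.1 Bs)

lemma sigmaX_le (d : ℕ) : sigmaX d ≤ (inferInstance : MeasurableSpace (Mat d × ℝ)) :=
  measurable_fst.comap_le

lemma loss_eq {d n : ℕ} (φ : ℕ → ℝ → ℝ) (Bs : Mat d) (fs : ℝ → ℝ) (θ : Mat d × (Fin n → ℝ))
    (z : Mat d × ℝ) : (z.2 - link φ θ.2 (pairing z.1 θ.1)) ^ 2 =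
      (z.2 - fs (pairing z.1 Bs)) ^ 2 +
        (regressionGap φ Bs fs θ z ^ 2 - 2 * regressionGap φ Bs fs θ z * noise Bs fs z) := by
  simp only [regressionGap, noise]
  ring

section Model

variable {d n : ℕ} {L σ C Cφ : ℝ} {I : Set ℝ} {φ : ℕ → ℝ → ℝ} {P : Measure (Mat d × ℝ)}
  {Bs : Mat d} {fs : ℝ → ℝ}

lemma measurable_link_pairing {T : Type*} [MeasurableSpace T] (hφ : IsDictionary φ I Cφ)
    {b : T → Fin n → ℝ} {X A : T → Mat d} (hb : Measurable b) (hX : Measurable X)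
    (hA : Measurable A) : Measurable fun x => link φ (b x) (pairing (X x) (A x)) := by
  have h1 : Measurable fun x => pairing (X x) (A x) := measurable_pairing_comp hX hA
  exact hφ.measurable_uncurry_link.comp (hb.prodMk h1)

lemma measurable_noise (hfs : Measurable fs) : Measurable (noise Bs fs) := by
  unfold noise
  fun_prop

/-- Measurability with respect to X alone is what allows the gap to be pulled out of conditional
expectations of the noise. -/
lemma stronglyMeasurable_regressionGap (hφ : IsDictionary φ I Cφ) (hfs : Measurable fs)
    (θ : Mat d × (Fin n → ℝ)) : StronglyMeasurable[sigmaX d] (regressionGap φ Bs fs θ) := by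
  have hg : Measurable fun X : Mat d => link φ θ.2 (pairing X θ.1) - fs (pairing X Bs) := by
    have hl := hφ.measurable_link θ.2
    fun_prop
  have hc : Measurable[sigmaX d] (regressionGap φ Bs fs θ) :=
    hg.comp (comap_measurable Prod.fst)
  exact hc.stronglyMeasurable

lemma ae_abs_regressionGap_le (hφ : IsDictionary φ I Cφ) (hB : AssumptionB P fs I C)
    (hIs : ∀ᵐ z ∂P, pairing z.1 Bs ∈ I) (hI : ∀ B ∈ unitPSD d, ∀ᵐ z ∂P, pairing z.1 B ∈ I)
    {θ : Mat d × (Fin n → ℝ)} (hθ1 : θ.1 ∈ unitPSD d) (hθ2 : weightedNorm θ.2 ≤ C + 1) :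
    ∀ᵐ z ∂P, |regressionGap φ Bs fs θ z| ≤ 2 * C + 1 := by
  filter_upwards [hIs, hI θ.1 hθ1] with z h1 h2
  refine (abs_sub _ _).trans ?_
  linarith [hφ.abs_link_le θ.2 h2, hB.link_le _ h1]

lemma integrable_noise_sq [IsProbabilityMeasure P] (hfs : Measurable fs) (hN : AssumptionN P Bs fs σ L) :
    Integrable (fun z => noise Bs fs z ^ 2) P ∧ Integrable (noise Bs fs) P := by
  have h : Integrable (fun z => noise Bs fs z ^ 2) P := by simpa using hN.integrable 2 le_rfl
  exact ⟨h, ((memLp_two_iff_integrable_sq (measurable_noise hfs).aestronglyMeasurable).mpr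
    h).integrable (by norm_num)⟩

/-- The excess risk is the mean square of the regression gap. -/
lemma risk_sub_risk_eq [IsProbabilityMeasure P] (hφ : IsDictionary φ I Cφ) (hfs : Measurable fs)
    (hN : AssumptionN P Bs fs σ L) (hB : AssumptionB P fs I C)
    (hIs : ∀ᵐ z ∂P, pairing z.1 Bs ∈ I) (hI : ∀ B ∈ unitPSD d, ∀ᵐ z ∂P, pairing z.1 B ∈ I)
    {θ : Mat d × (Fin n → ℝ)} (hθ1 : θ.1 ∈ unitPSD d) (hθ2 : weightedNorm θ.2 ≤ C + 1) :
    Integrable (fun z => regressionGap φ Bs fs θ z ^ 2) P ∧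
    risk P θ.1 (link φ θ.2) - risk P Bs fs = ∫ z, regressionGap φ Bs fs θ z ^ 2 ∂P := by
  have hb := ae_abs_regressionGap_le hφ hB hIs hI hθ1 hθ2
  have hm := stronglyMeasurable_regressionGap (Bs := Bs) hφ hfs θ
  have hm' := (hm.mono (sigmaX_le d)).measurable
  have hsq : Integrable (fun z => regressionGap φ Bs fs θ z ^ 2) P := by
    refine Integrable.of_bound (C := (2 * C + 1) ^ 2) (by fun_prop) ?_
    filter_upwards [hb] with z hz
    rw [Real.norm_of_nonneg (sq_nonneg _), ← sq_abs]
    exact pow_le_pow_left₀ (abs_nonneg _) hz 2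
  refine ⟨hsq, ?_⟩
  obtain ⟨hε2, hε⟩ := integrable_noise_sq hfs hN
  obtain ⟨hi, h0⟩ := integral_mul_eq_zero_of_condExp_eq_zero (P := P) (sigmaX_le d)
    (hm.const_mul 2) (K := 2 * (2 * C + 1)) (by
      filter_upwards [hb] with z hz
      rw [abs_mul, abs_two]
      linarith) hε hN.centred
  have hrs : risk P Bs fs = ∫ z, noise Bs fs z ^ 2 ∂P := rfl
  have hr : risk P θ.1 (link φ θ.2) = ∫ z, (noise Bs fs z ^ 2 +
      (regressionGap φ Bs fs θ z ^ 2 - 2 * regressionGap φ Bs fs θ z * noise Bs fs z)) ∂P :=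
    integral_congr_ae (ae_of_all _ fun z => loss_eq φ Bs fs θ z)
  have hadd : risk P θ.1 (link φ θ.2) = ∫ z, noise Bs fs z ^ 2 ∂P +
      ∫ z, (regressionGap φ Bs fs θ z ^ 2 -
        2 * regressionGap φ Bs fs θ z * noise Bs fs z) ∂P :=
    hr.trans (integral_add hε2 (hsq.sub hi))
  rw [hadd, integral_sub hsq hi, h0, hrs]
  ring

lemma measurable_risk_link [IsProbabilityMeasure P] (hφ : IsDictionary φ I Cφ) :
    Measurable fun θ : Mat d × (Fin n → ℝ) => risk P θ.1 (link φ θ.2) := by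
  refine (StronglyMeasurable.integral_prod_right' (ν := P)
    (f := fun p : (Mat d × (Fin n → ℝ)) × (Mat d × ℝ) =>
      (p.2.2 - link φ p.1.2 (pairing p.2.1 p.1.1)) ^ 2) ?_).measurable
  refine Measurable.stronglyMeasurable ?_
  have h := measurable_link_pairing hφ
    (b := fun p : (Mat d × (Fin n → ℝ)) × (Mat d × ℝ) => p.1.2) (X := fun p => p.2.1)
    (A := fun p => p.1.1) (by fun_prop) (by fun_prop) (by fun_prop)
  fun_prop

lemma measurable_empRisk_link {N : ℕ} {T : Type*} [MeasurableSpace T]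
    (hφ : IsDictionary φ I Cφ) {S : T → Fin N → Mat d × ℝ} {θ : T → Mat d × (Fin n → ℝ)}
    (hS : Measurable S) (hθ : Measurable θ) :
    Measurable fun x => empRisk (S x) (θ x).1 (link φ (θ x).2) := by
  unfold empRisk
  refine (Finset.measurable_sum _ fun i _ => ?_).const_mul _
  have h := measurable_link_pairing hφ (b := fun x => (θ x).2) (X := fun x => (S x i).1)
    (A := fun x => (θ x).1) (by fun_prop) (by fun_prop) (by fun_prop)
  fun_prop

lemma measurable_empRisk {N : ℕ} (hfs : Measurable fs) :
    Measurable fun S : Fin N → Mat d × ℝ => empRisk S Bs fs := by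
  unfold empRisk
  fun_prop

/-- Exponential moments of the centred empirical risk under the product law. -/
lemma lintegral_exp_empRisk_le [IsProbabilityMeasure P] {N : ℕ} (hN0 : 1 ≤ N) {κ : ℝ} (hL : 0 < L) (hκ : 0 < κ)
    (hbκ : 16 * (2 * C + 1) ^ 2 ≤ κ) (hσκ : 16 * σ ^ 2 ≤ κ) (hLκ : 32 * (2 * C + 1) * L ≤ κ)
    (hφ : IsDictionary φ I Cφ) (hfs : Measurable fs)
    (hN : AssumptionN P Bs fs σ L) (hB : AssumptionB P fs I C)
    (hIs : ∀ᵐ z ∂P, pairing z.1 Bs ∈ I) (hI : ∀ B ∈ unitPSD d, ∀ᵐ z ∂P, pairing z.1 B ∈ I)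
    {θ : Mat d × (Fin n → ℝ)} (hθ1 : θ.1 ∈ unitPSD d) (hθ2 : weightedNorm θ.2 ≤ C + 1) :
    ∫⁻ S : Fin N → Mat d × ℝ, ENNReal.ofReal (Real.exp (-(N / κ * empRisk S θ.1 (link φ θ.2) -
        N / κ * empRisk S Bs fs))) ∂(Measure.pi fun _ => P) ≤
      ENNReal.ofReal (Real.exp (-(N / κ / 2 * (risk P θ.1 (link φ θ.2) - risk P Bs fs)))) ∧
    ∫⁻ S : Fin N → Mat d × ℝ, ENNReal.ofReal (Real.exp (N / κ * empRisk S θ.1 (link φ θ.2) -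
        N / κ * empRisk S Bs fs)) ∂(Measure.pi fun _ => P) ≤
      ENNReal.ofReal (Real.exp (2 * (N / κ) * (risk P θ.1 (link φ θ.2) - risk P Bs fs))) := by
  have hm := stronglyMeasurable_regressionGap (Bs := Bs) hφ hfs θ
  have hm' := (hm.mono (sigmaX_le d)).measurable
  have hεm := measurable_noise (Bs := Bs) hfs
  have key := lintegral_exp_excess_le (P := P) (sigmaX_le d) hL hκ hbκ hσκ hLκ hεm
    hN.integrable hN.centred hN.moment_le hm (ae_abs_regressionGap_le hφ hB hIs hI hθ1 hθ2)
  have hN' : (0 : ℝ) < N := by exact_mod_cast hN0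
  -- The squared noise is common to both empirical risks and cancels, leaving a sum over the
  -- observations to which independence applies.
  have hsum : ∀ S : Fin N → Mat d × ℝ, N / κ * empRisk S θ.1 (link φ θ.2) -
      N / κ * empRisk S Bs fs = ∑ i, (regressionGap φ Bs fs θ (S i) ^ 2 -
        2 * regressionGap φ Bs fs θ (S i) * noise Bs fs (S i)) / κ := by
    intro S
    simp only [empRisk, loss_eq φ Bs fs θ]
    rw [Finset.sum_add_distrib, ← Finset.sum_div]
    field_simp
    ring
  rw [(risk_sub_risk_eq hφ hfs hN hB hIs hI hθ1 hθ2).2]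
  simp_rw [hsum, ← Finset.sum_neg_distrib, Real.exp_sum]
  simp_rw [ENNReal.ofReal_prod_of_nonneg fun _ _ => (Real.exp_pos _).le]
  constructor
  · rw [lintegral_pi_prod_eq_pow (P := P) N (f := fun z => ENNReal.ofReal (Real.exp
      (-((regressionGap φ Bs fs θ z ^ 2 - 2 * regressionGap φ Bs fs θ z * noise Bs fs z) / κ))))
      (by fun_prop)]
    refine (pow_le_pow_left' key.1 N).trans (le_of_eq ?_)
    rw [← ENNReal.ofReal_pow (Real.exp_pos _).le, ← Real.exp_nat_mul]
    congr 2
    ring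
  · rw [lintegral_pi_prod_eq_pow (P := P) N (f := fun z => ENNReal.ofReal (Real.exp
      ((regressionGap φ Bs fs θ z ^ 2 - 2 * regressionGap φ Bs fs θ z * noise Bs fs z) / κ)))
      (by fun_prop)]
    refine (pow_le_pow_left' key.2 N).trans (le_of_eq ?_)
    rw [← ENNReal.ofReal_pow (Real.exp_pos _).le, ← Real.exp_nat_mul]
    congr 2
    ring

/-- Stability of the excess risk with respect to the parameters. -/
lemma risk_sub_risk_le [IsProbabilityMeasure P] (hφ : IsDictionary φ I Cφ) (hIc : I.OrdConnected) (hCφ : 0 ≤ Cφ)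
    (hC : 0 ≤ C) (hfs : Measurable fs)
    (hN : AssumptionN P Bs fs σ L) (hB : AssumptionB P fs I C)
    (hIs : ∀ᵐ z ∂P, pairing z.1 Bs ∈ I) (hI : ∀ B ∈ unitPSD d, ∀ᵐ z ∂P, pairing z.1 B ∈ I)
    {θ θ₀ : Mat d × (Fin n → ℝ)} (hθ1 : θ.1 ∈ unitPSD d) (hθ2 : weightedNorm θ.2 ≤ C + 1)
    (h₀1 : θ₀.1 ∈ unitPSD d) (h₀2 : weightedNorm θ₀.2 ≤ C) {s τ : ℝ}
    (hs : ∀ i j, |θ.1 i j - θ₀.1 i j| ≤ s) (hτ : weightedNorm (θ.2 - θ₀.2) ≤ τ) :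
    risk P θ.1 (link φ θ.2) - risk P Bs fs ≤
      2 * (risk P θ₀.1 (link φ θ₀.2) - risk P Bs fs) + 2 * (τ + C * Cφ * (d ^ 2 * s)) ^ 2 := by
  obtain ⟨hi, e⟩ := risk_sub_risk_eq hφ hfs hN hB hIs hI hθ1 hθ2
  obtain ⟨hi₀, e₀⟩ := risk_sub_risk_eq hφ hfs hN hB hIs hI h₀1 (h₀2.trans (by linarith))
  rw [e, e₀]
  calc _ ≤ ∫ z, (2 * regressionGap φ Bs fs θ₀ z ^ 2 + 2 * (τ + C * Cφ * (d ^ 2 * s)) ^ 2) ∂P := by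
        refine integral_mono_ae hi ((hi₀.const_mul 2).add (integrable_const _)) ?_
        filter_upwards [hI _ hθ1, hI _ h₀1, hB.covariate] with z h1 h2 h3
        have hΔ : |regressionGap φ Bs fs θ z - regressionGap φ Bs fs θ₀ z| ≤
            τ + C * Cφ * (d ^ 2 * s) := by
          -- The coefficients are changed at the new matrix, then the matrix at the old
          -- coefficients; the Lipschitz constant is therefore C·Cφ and not (C + 1)·Cφ.
          have e1 : regressionGap φ Bs fs θ z - regressionGap φ Bs fs θ₀ z =
              link φ (θ.2 - θ₀.2) (pairing z.1 θ.1) +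
              (link φ θ₀.2 (pairing z.1 θ.1) - link φ θ₀.2 (pairing z.1 θ₀.1)) := by
            simp only [regressionGap, link_sub]
            ring
          rw [e1]
          refine (abs_add_le _ _).trans (add_le_add ((hφ.abs_link_le _ h1).trans hτ) ?_)
          refine (hφ.abs_link_sub_le hIc _ h1 h2).trans ?_
          have := abs_pairing_sub_le h3 hs
          gcongr
        have h4 := sq_le_sq' (abs_le.mp hΔ).1 (abs_le.mp hΔ).2
        -- With x, y the new and old gaps, 2y² + 2(x - y)² - x² = (x - 2y)².
        nlinarith [sq_nonneg (regressionGap φ Bs fs θ z - 2 * regressionGap φ Bs fs θ₀ z)]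
    _ = _ := by
        rw [integral_add (hi₀.const_mul 2) (integrable_const _), integral_const_mul]
        simp

end Model


/-! ### Comparison of the prior mass with the complexity term. -/

lemma one_le_rank_of_mem_unitPSD {d : ℕ} {B : Mat d} (hB : B ∈ unitPSD d) : 1 ≤ B.rank := by
  obtain ⟨U, y, -, hy1, -, hcard⟩ := exists_conj_diagonal_of_mem_unitPSD hB
  rw [← hcard, Nat.one_le_iff_ne_zero, Finset.card_ne_zero]
  by_contra h
  rw [Finset.not_nonempty_iff_eq_empty, Finset.filter_eq_empty_iff] at h
  have : ∑ k, y k ^ 2 = 0 := Finset.sum_eq_zero fun k hk => by simpa using h hk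
  linarith

lemma one_le_log_sixteen_mul {n : ℕ} (hn : 1 ≤ n) : 1 ≤ Real.log (16 * n) := by
  have hn' : (1 : ℝ) ≤ n := by exact_mod_cast hn
  rw [Real.le_log_iff_exp_le (by positivity)]
  have := Real.exp_one_lt_d9
  linarith

lemma half_le_log_two_div {δ : ℝ} (hδ0 : 0 < δ) (hδ1 : δ < 1) : 1 / 2 ≤ Real.log (2 / δ) := by
  have h : Real.log 2 ≤ Real.log (2 / δ) := by
    refine Real.log_le_log two_pos ?_
    rw [le_div_iff₀ hδ0]
    linarith
  linarith [Real.log_two_gt_d9]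

/-- Lower bounds for the complexity term. -/
lemma le_mul_complexity {n d M r : ℕ} {C δ : ℝ} (hn : 1 ≤ n) (hd : 1 ≤ d) :
    M * Real.log (C * n) + r * d * Real.log (16 * n) + Real.log (2 / δ) ≤
      n * complexity n d M r C δ := by
  have hn' : (1 : ℝ) ≤ n := by exact_mod_cast hn
  have hd' : (1 : ℝ) ≤ d := by exact_mod_cast hd
  have h1 : 0 ≤ Real.log d := Real.log_nonneg hd'
  have h2 : 0 ≤ Real.log (2 * n * Real.exp 1) := by
    refine Real.log_nonneg ?_
    have : 1 ≤ Real.exp 1 := Real.one_le_exp zero_le_one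
    nlinarith
  -- The d log d term of the complexity is used only through its sign.
  have h3 : 0 ≤ d * Real.log d * Real.log (2 * n * Real.exp 1) := by positivity
  rw [complexity, mul_div_cancel₀ _ (by positivity)]
  linarith

/-- The logarithm of the prior mass of a neighbourhood is bounded by the complexity. -/
lemma log_inv_mass_le {n d M r : ℕ} {C D₁ : ℝ} (hn : 2 ≤ n) (hd : 1 ≤ d) (hdn : d ≤ n)
    (hr : 1 ≤ r) (hC : 1 ≤ C) (hD₁ : 0 < D₁) :
    Real.log (1 / ((((2 * (4 * n ^ 5) + 1 : ℕ) : ℝ) ^ (d * r))⁻¹ *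
        (D₁ / d * Real.exp (-2) / 2 * (1 / (4 * n ^ 9))) ^ d *
        (1 / 10 * (1 / n / (C + 1))) ^ M)) ≤
      (16 + |Real.log D₁| + 2 * Real.log (10 * (C + 1))) *
        (M * Real.log (C * n) + r * d * Real.log (16 * n)) := by
  have hn' : (2 : ℝ) ≤ n := by exact_mod_cast hn
  have hd' : (1 : ℝ) ≤ d := by exact_mod_cast hd
  have hdn' : (d : ℝ) ≤ n := by exact_mod_cast hdn
  have hr' : (1 : ℝ) ≤ r := by exact_mod_cast hr
  have hn0 : (0 : ℝ) < n := by linarith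
  have hd0 : (0 : ℝ) < d := by linarith
  have hl : 1 ≤ Real.log (16 * n) := one_le_log_sixteen_mul (by omega)
  set ℓ := Real.log (16 * n) with hℓ
  set q := Real.log (C * n) with hq
  have hq0 : Real.log n ≤ q := Real.log_le_log hn0 (by nlinarith)
  have hq1 : 1 / 2 ≤ q := by
    have : Real.log 2 ≤ Real.log n := Real.log_le_log two_pos hn'
    linarith [Real.log_two_gt_d9]
  have hc : 0 ≤ Real.log (10 * (C + 1)) := Real.log_nonneg (by linarith)
  have hD := abs_nonneg (Real.log D₁)
  have e : Real.log (1 / ((((2 * (4 * n ^ 5) + 1 : ℕ) : ℝ) ^ (d * r))⁻¹ *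
        (D₁ / d * Real.exp (-2) / 2 * (1 / (4 * n ^ 9))) ^ d *
        (1 / 10 * (1 / n / (C + 1))) ^ M)) =
      d * r * Real.log (8 * n ^ 5 + 1) + d * (Real.log (8 * Real.exp 2 * d * n ^ 9) - Real.log D₁)
        + M * (Real.log (10 * (C + 1)) + Real.log n) := by
    rw [one_div, Real.log_inv, Real.log_mul (by positivity) (by positivity),
      Real.log_mul (by positivity) (by positivity), Real.log_inv, Real.log_pow, Real.log_pow,
      Real.log_pow]
    have e1 : D₁ / d * Real.exp (-2) / 2 * (1 / (4 * n ^ 9)) =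
        D₁ / (8 * Real.exp 2 * d * n ^ 9) := by
      rw [Real.exp_neg]
      field_simp
      norm_num
    have e2 : 1 / 10 * (1 / (n : ℝ) / (C + 1)) = (10 * (C + 1) * n)⁻¹ := by
      field_simp
    rw [e1, e2, Real.log_inv, Real.log_mul (by positivity) hn0.ne',
      Real.log_div hD₁.ne' (by positivity)]
    push_cast
    ring_nf
  have b1 : Real.log (8 * n ^ 5 + 1) ≤ 5 * ℓ := by
    rw [hℓ, show (5 : ℝ) = ((5 : ℕ) : ℝ) by norm_num, ← Real.log_pow]
    refine Real.log_le_log (by positivity) ?_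
    have : (1 : ℝ) ≤ n ^ 5 := one_le_pow₀ (by linarith)
    rw [mul_pow]
    linarith
  have b2 : Real.log (8 * Real.exp 2 * d * n ^ 9) ≤ 10 * ℓ := by
    rw [hℓ, show (10 : ℝ) = ((10 : ℕ) : ℝ) by norm_num, ← Real.log_pow]
    refine Real.log_le_log (by positivity) ?_
    have h1 : Real.exp 2 ≤ 9 := by
      have h2 : Real.exp 2 = Real.exp 1 * Real.exp 1 := by rw [← Real.exp_add]; norm_num
      have := Real.exp_one_lt_d9
      have := Real.exp_pos 1
      nlinarith
    calc 8 * Real.exp 2 * d * n ^ 9 ≤ 8 * 9 * n * n ^ 9 := by gcongr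
      _ = 72 * (n : ℝ) ^ 10 := by ring
      _ ≤ 16 ^ 10 * (n : ℝ) ^ 10 := by gcongr; norm_num
      _ = _ := by rw [mul_pow]
  rw [e]
  -- As the rank is at least 1, the d Dirichlet coordinates cost no more than the rank term.
  have hdr : (d : ℝ) ≤ r * d := by nlinarith
  have c1 : d * r * Real.log (8 * n ^ 5 + 1) ≤ 5 * (r * d * ℓ) := by
    calc _ ≤ d * r * (5 * ℓ) := by gcongr
      _ = _ := by ring
  have c2 : d * (Real.log (8 * Real.exp 2 * d * n ^ 9) - Real.log D₁) ≤
      (10 + |Real.log D₁|) * (r * d * ℓ) := by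
    have h1 : Real.log (8 * Real.exp 2 * d * n ^ 9) - Real.log D₁ ≤ (10 + |Real.log D₁|) * ℓ := by
      have := neg_abs_le (Real.log D₁)
      nlinarith
    calc _ ≤ d * ((10 + |Real.log D₁|) * ℓ) := by gcongr
      _ ≤ (r * d) * ((10 + |Real.log D₁|) * ℓ) := by gcongr
      _ = _ := by ring
  have c3 : M * (Real.log (10 * (C + 1)) + Real.log n) ≤
      (1 + 2 * Real.log (10 * (C + 1))) * (M * q) := by
    calc _ ≤ M * ((1 + 2 * Real.log (10 * (C + 1))) * q) := by
          gcongr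
          nlinarith
      _ = _ := by ring
  have x1 : 0 ≤ M * q := by positivity
  have x2 : 0 ≤ r * d * ℓ := by positivity
  linarith [mul_nonneg hc x2, mul_nonneg hD x1]

/-- The powers n⁹ and n⁵ are chosen here: with d ≤ n, eigenvalues and eigenvectors each contribute
at most 1/(2n) to the change of the pairing. Only the logarithms of these powers enter the final
bound. -/
lemma neighbourhood_radius_le {n d : ℕ} (hd : 1 ≤ d) (hdn : d ≤ n) :
    (d : ℝ) ^ 2 * (d * (√(d * (1 / (4 * n ^ 9))) + 2 * (d / ((4 * n ^ 5 : ℕ) : ℝ)))) ≤ 1 / n := by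
  have hd' : (1 : ℝ) ≤ d := by exact_mod_cast hd
  have hdn' : (d : ℝ) ≤ n := by exact_mod_cast hdn
  have hn0 : (0 : ℝ) < n := by linarith
  have h1 : √(d * (1 / (4 * n ^ 9)) : ℝ) ≤ 1 / (2 * n ^ 4) := by
    rw [Real.sqrt_le_iff]
    refine ⟨by positivity, ?_⟩
    calc (d * (1 / (4 * n ^ 9)) : ℝ) ≤ n * (1 / (4 * n ^ 9)) := by gcongr
      _ = _ := by field_simp; norm_num
  calc _ ≤ (n : ℝ) ^ 2 * (n * (1 / (2 * n ^ 4) + 2 * (n / ((4 * n ^ 5 : ℕ) : ℝ)))) := by gcongr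
    _ = 1 / n := by
      push_cast
      field_simp
      norm_num

/-! ### The oracle inequality for one competitor. -/

section Oracle

variable {L σ C Cφ D₁ : ℝ}

/-- The constant in the oracle inequality for a fixed competitor. -/
noncomputable def oracleConst (L σ C Cφ D₁ : ℝ) : ℝ :=
  8 + 16 * (1 + C * Cφ) ^ 2 + (2 * C + 1) ^ 2 + 2 * (wConst C L + 2 * c1Const C σ) *
    (18 + |Real.log D₁| + 2 * Real.log (10 * (C + 1)))

/-- These are the requirements of `lintegral_exp_excess_le` with b = 2C + 1, the bound on the
regression gap: w supplies those on b² and bL, and 2C₁ the one on σ². -/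
lemma temperature_bounds (hL : 0 < L) (hC : 1 ≤ C) :
    0 < wConst C L + 2 * c1Const C σ ∧
    16 * (2 * C + 1) ^ 2 ≤ wConst C L + 2 * c1Const C σ ∧
    16 * σ ^ 2 ≤ wConst C L + 2 * c1Const C σ ∧
    32 * (2 * C + 1) * L ≤ wConst C L + 2 * c1Const C σ := by
  have h1 : 64 * (C + 1) * L ≤ wConst C L := by
    unfold wConst
    gcongr
    exact le_max_left _ _
  have h2 : 64 * (C + 1) * (C + 1) ≤ wConst C L := by
    unfold wConst
    gcongr
    exact le_max_right _ _
  unfold c1Const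
  refine ⟨?_, ?_, ?_, ?_⟩ <;> nlinarith [sq_nonneg σ, mul_pos hL (by linarith : 0 < C)]

/-- Here v is the competitor's excess risk and c its complexity. The remainder (a/n)² is absorbed
since c ≥ 1/(2n), and 8 is the ratio of 2(n/κ)·2v to (n/κ/2)·v. The summand b is slack, present
because the case d ≥ n needs it in the same constant. -/
lemma temperature_arithmetic {n κ v c K a b : ℝ} (hn : 1 ≤ n) (hκ : 0 < κ) (hv : 0 ≤ v)
    (hc : 1 / 2 ≤ n * c) (hK : 0 ≤ K) (hb : 0 ≤ b) :
    2 * (n / κ) * (2 * v + 2 * (a / n) ^ 2) + K * (n * c) ≤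
      n / κ / 2 * ((8 + 16 * a ^ 2 + b + 2 * κ * K) * (v + c)) := by
  have hn0 : 0 < n := by linarith
  have hc0 : 0 ≤ c := nonneg_of_mul_nonneg_right (by linarith : 0 ≤ n * c) hn0
  have h1 : (a / n) ^ 2 ≤ 2 * a ^ 2 * c := by
    have h2 : 1 ≤ n ^ 2 * (2 * c) := by nlinarith
    rw [div_pow, div_le_iff₀ (by positivity)]
    linarith [mul_le_mul_of_nonneg_left h2 (sq_nonneg a)]
  have e : K * (n * c) = n / κ / 2 * (2 * κ * K * c) := by field_simp
  have y1 : 0 ≤ (16 * a ^ 2 + b + 2 * κ * K) * v := by positivity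
  have y2 : 0 ≤ (8 + b) * c := by positivity
  calc 2 * (n / κ) * (2 * v + 2 * (a / n) ^ 2) + K * (n * c)
      = n / κ / 2 * (8 * v + 8 * (a / n) ^ 2 + 2 * κ * K * c) := by rw [e]; ring
    _ ≤ _ := mul_le_mul_of_nonneg_left (by linarith) (by positivity)

variable {n d : ℕ} {α : Fin d → ℝ} {I : Set ℝ} {φ : ℕ → ℝ → ℝ} {P : Measure (Mat d × ℝ)}
  {Bs : Mat d} {fs : ℝ → ℝ}

lemma isProbabilityMeasure_prior (hn : 1 ≤ n) (hC : 0 ≤ C) (hα : ∀ i, 0 < α i) :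
    IsProbabilityMeasure (prior n α C) := by
  have := isProbabilityMeasure_matrixPrior hα
  have := isProbabilityMeasure_linkPrior hn hC
  unfold prior
  infer_instance

lemma ae_prior (hn : 1 ≤ n) (hd : 1 ≤ d) (hC : 0 ≤ C) (hα : ∀ i, 0 < α i) :
    ∀ᵐ θ ∂prior n α C, θ.1 ∈ unitPSD d ∧ weightedNorm θ.2 ≤ C + 1 := by
  have := isProbabilityMeasure_matrixPrior hα
  have := isProbabilityMeasure_linkPrior hn hC
  have h1 := Measure.quasiMeasurePreserving_fst (μ := matrixPrior α) (ν := linkPrior n C)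
    |>.ae (ae_matrixPrior_mem_unitPSD hd hα)
  have h2 := Measure.quasiMeasurePreserving_snd (μ := matrixPrior α) (ν := linkPrior n C)
    |>.ae (ae_linkPrior_weightedNorm_le (n := n) (C := C))
  filter_upwards [h1, h2] with θ h3 h4 using ⟨h3, h4⟩

lemma empRisk_nonneg {N : ℕ} (S : Fin N → Mat d × ℝ) (B : Mat d) (f : ℝ → ℝ) :
    0 ≤ empRisk S B f := by
  unfold empRisk
  exact mul_nonneg (by positivity) (Finset.sum_nonneg fun i _ => sq_nonneg _)

lemma isProbabilityMeasure_gibbs (hφ : IsDictionary φ I Cφ) (hn : 1 ≤ n) (hC : 0 ≤ C)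
    (hα : ∀ i, 0 < α i) {lam : ℝ} (hlam : 0 ≤ lam) (S : Fin n → Mat d × ℝ) :
    IsProbabilityMeasure (gibbs α φ C lam S) := by
  have := isProbabilityMeasure_prior (n := n) hn hC hα
  have hm : Measurable fun θ : Mat d × (Fin n → ℝ) => empRisk S θ.1 (link φ θ.2) :=
    measurable_empRisk_link hφ measurable_const measurable_id
  refine isProbabilityMeasure_tilted ?_
  refine Integrable.of_bound (C := 1) (hm.const_mul _).exp.aestronglyMeasurable
    (ae_of_all _ fun θ => ?_)
  rw [Real.norm_of_nonneg (Real.exp_pos _).le, Real.exp_le_one_iff, neg_mul]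
  exact neg_nonpos.mpr (mul_nonneg hlam (empRisk_nonneg S _ _))

/-- Concentration of the Gibbs posterior on parameters of small excess risk. -/
theorem one_sub_le_lintegral_gibbs [IsProbabilityMeasure P] (hL : 0 < L) (hC : 1 ≤ C)
    (hn : 1 ≤ n) (hd : 1 ≤ d) (hα : ∀ i, 0 < α i) (hφ : IsDictionary φ I Cφ)
    (hfs : Measurable fs) (hN : AssumptionN P Bs fs σ L) (hB : AssumptionB P fs I C)
    (hIs : ∀ᵐ z ∂P, pairing z.1 Bs ∈ I) (hI : ∀ B ∈ unitPSD d, ∀ᵐ z ∂P, pairing z.1 B ∈ I)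
    {δ p r t : ℝ} (hδ0 : 0 < δ) (hp : 0 < p)
    (hmass : ENNReal.ofReal p ≤
      prior n α C {θ | risk P θ.1 (link φ θ.2) - risk P Bs fs ≤ r})
    (ht : 2 * invTemp n C σ L * r + Real.log (1 / p) + 2 * Real.log (1 / δ) ≤
      invTemp n C σ L / 2 * t) :
    ENNReal.ofReal (1 - δ) ≤ ∫⁻ S : Fin n → Mat d × ℝ, gibbs α φ C (invTemp n C σ L) S
      {θ | risk P θ.1 (link φ θ.2) - risk P Bs fs ≤ t} ∂(Measure.pi fun _ : Fin n => P) := by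
  have hC0 : 0 ≤ C := by linarith
  have hprob := isProbabilityMeasure_prior (n := n) hn hC0 hα
  have hae := ae_prior (n := n) hn hd hC0 hα
  obtain ⟨hκ, hbκ, hσκ, hLκ⟩ := temperature_bounds (σ := σ) hL hC
  have hlam0 : 0 ≤ invTemp n C σ L := div_nonneg (Nat.cast_nonneg n) hκ.le
  have hmom := fun (θ : Mat d × (Fin n → ℝ)) (h : θ.1 ∈ unitPSD d ∧ weightedNorm θ.2 ≤ C + 1) =>
    lintegral_exp_empRisk_le (N := n) hn hL hκ hbκ hσκ hLκ hφ hfs hN hB hIs hI h.1 h.2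
  have hlam : (n : ℝ) / (wConst C L + 2 * c1Const C σ) = invTemp n C σ L := rfl
  rw [hlam] at hmom
  have hm1 : Measurable fun q : (Mat d × (Fin n → ℝ)) × (Fin n → Mat d × ℝ) =>
      empRisk q.2 q.1.1 (link φ q.1.2) :=
    measurable_empRisk_link hφ measurable_snd measurable_fst
  have hm2 : Measurable fun S : Fin n → Mat d × ℝ => empRisk S Bs fs := measurable_empRisk hfs
  have hm3 : Measurable fun θ : Mat d × (Fin n → ℝ) => risk P θ.1 (link φ θ.2) :=
    measurable_risk_link hφ
  set lam := invTemp n C σ L with hlamdef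
  set ℓ : Mat d × (Fin n → ℝ) → (Fin n → Mat d × ℝ) → ℝ :=
    fun θ S => lam * empRisk S θ.1 (link φ θ.2) with hℓ
  have hℓm : Measurable (Function.uncurry ℓ) := hm1.const_mul lam
  have hgibbs : ∀ S, gibbs α φ C lam S = (prior n α C).tilted fun θ => -ℓ θ S := fun S => by
    simp only [gibbs, hℓ, neg_mul]
  simp_rw [hgibbs]
  exact one_sub_le_lintegral_tilted (μ := prior n α C) (Q := Measure.pi fun _ : Fin n => P)
    hℓm (fun θ S => mul_nonneg hlam0 (empRisk_nonneg S _ _))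
    (hm2.const_mul lam) (e := fun θ => risk P θ.1 (link φ θ.2) - risk P Bs fs)
    (hm3.sub_const _) (a := lam / 2) (b := 2 * lam) (by positivity) (by positivity) hp hδ0
    (hae.mono fun θ h => (hmom θ h).1) (hae.mono fun θ h => (hmom θ h).2) hmass ht

/-- The excess risk is bounded on the support of the Gibbs posterior. -/
lemma gibbs_excess_le_eq_one [IsProbabilityMeasure P] (hL : 0 < L) (hC : 1 ≤ C)
    (hn : 1 ≤ n) (hd : 1 ≤ d) (hα : ∀ i, 0 < α i) (hφ : IsDictionary φ I Cφ)
    (hfs : Measurable fs) (hN : AssumptionN P Bs fs σ L) (hB : AssumptionB P fs I C)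
    (hIs : ∀ᵐ z ∂P, pairing z.1 Bs ∈ I) (hI : ∀ B ∈ unitPSD d, ∀ᵐ z ∂P, pairing z.1 B ∈ I)
    {t : ℝ} (ht : (2 * C + 1) ^ 2 ≤ t) (S : Fin n → Mat d × ℝ) :
    gibbs α φ C (invTemp n C σ L) S {θ | risk P θ.1 (link φ θ.2) - risk P Bs fs ≤ t} = 1 := by
  have hC0 : 0 ≤ C := by linarith
  have hae := ae_prior (n := n) hn hd hC0 hα
  have := isProbabilityMeasure_gibbs (n := n) hφ hn hC0 hα (lam := invTemp n C σ L)
    (div_nonneg (Nat.cast_nonneg n) (temperature_bounds hL hC).1.le) S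
  suffices h : ∀ᵐ θ ∂prior n α C, risk P θ.1 (link φ θ.2) - risk P Bs fs ≤ t by
    have h2 : ∀ᵐ θ ∂gibbs α φ C (invTemp n C σ L) S,
        risk P θ.1 (link φ θ.2) - risk P Bs fs ≤ t :=
      (tilted_absolutelyContinuous (prior n α C) _).ae_le h
    exact (measure_congr (Filter.eventuallyEq_univ.mpr h2)).trans this.measure_univ
  filter_upwards [hae] with θ hθ
  obtain ⟨hi, he⟩ := risk_sub_risk_eq (θ := θ) hφ hfs hN hB hIs hI hθ.1 hθ.2
  rw [he]
  calc _ ≤ ∫ _, (2 * C + 1) ^ 2 ∂P := by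
        refine integral_mono_ae hi (integrable_const _) ?_
        filter_upwards [ae_abs_regressionGap_le hφ hB hIs hI hθ.1 hθ.2] with z hz
        rw [← sq_abs]
        exact pow_le_pow_left₀ (abs_nonneg _) hz 2
    _ ≤ t := by simpa using ht

/-- The prior charges the parameters whose excess risk is comparable to that of a competitor. -/
lemma le_prior_excess [IsProbabilityMeasure P] (hC : 1 ≤ C)
    (hCφ : 0 < Cφ) (hD₁ : 0 < D₁) (hd : 1 ≤ d) (hdn : d ≤ n) (hα1 : ∑ i, α i = 1)
    (hα : ∀ i, D₁ / d ≤ α i) (hIc : I.OrdConnected) (hφ : IsDictionary φ I Cφ)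
    (hfs : Measurable fs) (hN : AssumptionN P Bs fs σ L) (hB : AssumptionB P fs I C)
    (hIs : ∀ᵐ z ∂P, pairing z.1 Bs ∈ I) (hI : ∀ B ∈ unitPSD d, ∀ᵐ z ∂P, pairing z.1 B ∈ I)
    {M : ℕ} (hM : 1 ≤ M) (hMn : M ≤ n) {B : Mat d} (hBu : B ∈ unitPSD d) {β : Fin M → ℝ}
    (hβ : weightedNorm β ≤ C) :
    ENNReal.ofReal ((((2 * (4 * n ^ 5) + 1 : ℕ) : ℝ) ^ (d * B.rank))⁻¹ *
        (D₁ / d * Real.exp (-2) / 2 * (1 / (4 * n ^ 9))) ^ d *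
        (1 / 10 * (1 / n / (C + 1))) ^ M) ≤
      prior n α C {θ | risk P θ.1 (link φ θ.2) - risk P Bs fs ≤
        2 * (risk P B (link φ (pad M n β)) - risk P Bs fs) + 2 * ((1 + C * Cφ) / n) ^ 2} := by
  have hn : 1 ≤ n := hd.trans hdn
  have hd0 : (0 : ℝ) < d := by exact_mod_cast hd
  have hn1 : (1 : ℝ) ≤ n := by exact_mod_cast hn
  have hn0 : (0 : ℝ) < n := by linarith
  have hC0 : 0 ≤ C := by linarith
  have hαpos : ∀ i, 0 < α i := fun i => (by positivity : 0 < D₁ / d).trans_le (hα i)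
  have hae := ae_prior (n := n) hn hd hC0 hαpos
  have hn9 : (1 : ℝ) ≤ n ^ 9 := one_le_pow₀ hn1
  have hmass1 := le_matrixPrior (τ := 1 / (4 * n ^ 9)) hD₁ hα1 hα (by positivity)
    (by rw [div_le_one (by positivity)]; linarith) (K := 4 * n ^ 5) (by positivity) hBu
  have hmass2 := le_linkPrior (n := n) hM hMn hC0 (τ := 1 / n) (by positivity)
    (by rw [div_le_one hn0]; exact hn1) hβ
  have hrad := neighbourhood_radius_le hd hdn
  set s := (d : ℝ) * (√(d * (1 / (4 * n ^ 9))) + 2 * (d / ((4 * n ^ 5 : ℕ) : ℝ))) with hs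
  rw [ENNReal.ofReal_mul (by positivity)]
  have := isProbabilityMeasure_linkPrior hn hC0
  refine (mul_le_mul' hmass1 hmass2).trans ?_
  rw [← Measure.prod_prod]
  refine measure_mono_ae ?_
  filter_upwards [hae] with θ hθ hmem
  have h := risk_sub_risk_le (θ := θ) (θ₀ := (B, pad M n β)) hφ hIc hCφ.le hC0 hfs hN hB hIs hI
    hθ.1 hθ.2 hBu ((weightedNorm_pad hMn β).trans_le hβ) hmem.1 hmem.2
  refine h.trans ?_
  have hs0 : 0 ≤ s := by positivity
  have hle : 1 / n + C * Cφ * (d ^ 2 * s) ≤ (1 + C * Cφ) / n := by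
    calc 1 / n + C * Cφ * (d ^ 2 * s) ≤ 1 / n + C * Cφ * (1 / n) := by gcongr
      _ = _ := by ring
  gcongr

/-- The oracle inequality against one competitor. -/
theorem oracle_inequality_of_competitor [IsProbabilityMeasure P] (hL : 0 < L) (hC : 1 ≤ C)
    (hCφ : 0 < Cφ) (hD₁ : 0 < D₁) (hn : 1 ≤ n) (hd : 1 ≤ d) (hα1 : ∑ i, α i = 1)
    (hα : ∀ i, D₁ / d ≤ α i) (hIc : I.OrdConnected) (hφ : IsDictionary φ I Cφ)
    (hfs : Measurable fs) (hN : AssumptionN P Bs fs σ L) (hB : AssumptionB P fs I C)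
    (hIs : ∀ᵐ z ∂P, pairing z.1 Bs ∈ I) (hI : ∀ B ∈ unitPSD d, ∀ᵐ z ∂P, pairing z.1 B ∈ I)
    {δ : ℝ} (hδ0 : 0 < δ) (hδ1 : δ < 1) {M : ℕ} (hM : 1 ≤ M) (hMn : M ≤ n) {B : Mat d}
    (hBu : B ∈ unitPSD d) {f : ℝ → ℝ} (hf : f ∈ approxClass φ M C) :
    1 / (2 * n) ≤ risk P B f - risk P Bs fs + complexity n d M B.rank C δ ∧
    ENNReal.ofReal (1 - δ) ≤ ∫⁻ S : Fin n → Mat d × ℝ, gibbs α φ C (invTemp n C σ L) S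
      {θ | risk P θ.1 (link φ θ.2) - risk P Bs fs ≤ oracleConst L σ C Cφ D₁ *
        (risk P B f - risk P Bs fs + complexity n d M B.rank C δ)}
      ∂(Measure.pi fun _ : Fin n => P) := by
  obtain ⟨β, hβ, rfl⟩ := hf
  have hβn : weightedNorm β ≤ C := hβ.1
  simp only
  have hd0 : (0 : ℝ) < d := by exact_mod_cast hd
  have hn1 : (1 : ℝ) ≤ n := by exact_mod_cast hn
  have hn0 : (0 : ℝ) < n := by linarith
  have hC0 : 0 ≤ C := by linarith
  have hαpos : ∀ i, 0 < α i := fun i => (by positivity : 0 < D₁ / d).trans_le (hα i)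
  have hprob := isProbabilityMeasure_prior (n := n) hn hC0 hαpos
  have hae := ae_prior (n := n) hn hd hC0 hαpos
  obtain ⟨hκ, hbκ, hσκ, hLκ⟩ := temperature_bounds (σ := σ) hL hC
  set κ := wConst C L + 2 * c1Const C σ with hκdef
  have hlam : invTemp n C σ L = n / κ := rfl
  set θ₀ : Mat d × (Fin n → ℝ) := (B, pad M n β) with hθ₀
  have hθ₀n : weightedNorm θ₀.2 ≤ C := (weightedNorm_pad hMn β).trans_le hβn
  have hθ₀l : link φ β = link φ θ₀.2 := (link_pad hMn φ β).symm
  rw [hθ₀l]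
  have hr := one_le_rank_of_mem_unitPSD hBu
  have hr' : (1 : ℝ) ≤ B.rank := by exact_mod_cast hr
  obtain ⟨-, he₀⟩ := risk_sub_risk_eq (θ := θ₀) hφ hfs hN hB hIs hI hBu (by linarith)
  have hv0 : 0 ≤ risk P B (link φ θ₀.2) - risk P Bs fs := by
    rw [show B = θ₀.1 from rfl, he₀]
    exact integral_nonneg fun z => sq_nonneg _
  set v := risk P B (link φ θ₀.2) - risk P Bs fs with hv
  have hcomp := le_mul_complexity (M := M) (r := B.rank) hn hd (C := C) (δ := δ)
  have hδl := half_le_log_two_div hδ0 hδ1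
  have hl16 := one_le_log_sixteen_mul hn
  have hlC : 0 ≤ Real.log (C * n) := Real.log_nonneg (by nlinarith)
  set comp := complexity n d M B.rank C δ with hcompdef
  have hm1 : 0 ≤ M * Real.log (C * n) := by positivity
  have hm2 : 0 ≤ B.rank * d * Real.log (16 * n) := by positivity
  have hcomp1 : 1 / (2 * n) ≤ comp := by
    rw [div_le_iff₀ (by positivity)]
    linarith
  have hcomp0 : 0 < comp := lt_of_lt_of_le (by positivity) hcomp1
  refine ⟨by linarith, ?_⟩
  have hlogC : 0 ≤ Real.log (10 * (C + 1)) := Real.log_nonneg (by linarith)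
  have hK0 : 0 ≤ 18 + |Real.log D₁| + 2 * Real.log (10 * (C + 1)) := by positivity
  -- If n ≤ d, the rank term alone makes the complexity at least 1, and the excess risk never
  -- exceeds (2C + 1)² on the support. Otherwise d < n, as the choice of radii requires.
  rcases le_or_gt n d with hnd | hdn
  · have hone : 1 ≤ comp := by
      have hnd' : (n : ℝ) ≤ d := by exact_mod_cast hnd
      have h1 : (n : ℝ) ≤ B.rank * d * Real.log (16 * n) := by
        calc (n : ℝ) ≤ 1 * d * 1 := by linarith
          _ ≤ _ := by gcongr
      by_contra h
      nlinarith [not_le.mp h]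
    have hΞ : (2 * C + 1) ^ 2 ≤ oracleConst L σ C Cφ D₁ := by
      unfold oracleConst
      rw [← hκdef]
      have : 0 ≤ 2 * κ * (18 + |Real.log D₁| + 2 * Real.log (10 * (C + 1))) := by positivity
      nlinarith [sq_nonneg (1 + C * Cφ)]
    have hfull := gibbs_excess_le_eq_one (n := n) (σ := σ) hL hC hn hd hαpos hφ hfs hN hB hIs hI
      (t := oracleConst L σ C Cφ D₁ * (v + comp)) 
      (hΞ.trans (le_mul_of_one_le_right ((sq_nonneg _).trans hΞ) (by linarith)))
    simp only [hfull, lintegral_const, measure_univ, mul_one]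
    rw [← ENNReal.ofReal_one]
    exact ENNReal.ofReal_le_ofReal (by linarith)
  · have hn2 : 2 ≤ n := by omega
    have hlog := log_inv_mass_le hn2 hd hdn.le hr hC hD₁ (M := M)
    refine one_sub_le_lintegral_gibbs hL hC hn hd hαpos hφ hfs hN hB hIs hI hδ0 (by positivity)
      (le_prior_excess hC hCφ hD₁ hd hdn.le hα1 hα hIc hφ hfs hN hB hIs hI hM hMn hBu hβn) ?_
    change 2 * (n / κ) * (2 * v + 2 * ((1 + C * Cφ) / n) ^ 2) + _ + _ ≤ _
    refine (add_le_add_left (add_le_add_right hlog _) _).trans ?_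
    rw [hlam]
    have hlogδ : Real.log (1 / δ) ≤ Real.log (2 / δ) :=
      Real.log_le_log (by positivity) (by gcongr; norm_num)
    -- Of the 18, 16 comes from the prior mass and 2 pays for 2 log(1/δ).
    set K := 18 + |Real.log D₁| + 2 * Real.log (10 * (C + 1)) with hKdef
    have h1 : (16 + |Real.log D₁| + 2 * Real.log (10 * (C + 1))) *
        (M * Real.log (C * n) + B.rank * d * Real.log (16 * n)) + 2 * Real.log (1 / δ) ≤
        K * (n * comp) := by
      have h2 : (16 + |Real.log D₁| + 2 * Real.log (10 * (C + 1))) *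
          (M * Real.log (C * n) + B.rank * d * Real.log (16 * n)) ≤
          (16 + |Real.log D₁| + 2 * Real.log (10 * (C + 1))) * (n * comp) := by
        gcongr
        linarith
      rw [hKdef]
      linarith
    have h2 := temperature_arithmetic (a := 1 + C * Cφ) (b := (2 * C + 1) ^ 2) (K := K) hn1 hκ hv0
      (by linarith : 1 / 2 ≤ n * comp) hK0 (sq_nonneg _)
    unfold oracleConst
    rw [← hκdef, ← hKdef]
    linarith

end Oracle

end LowRankSIM

/-! ### From one competitor to all of them simultaneously. -/

open LowRankSIM
theorem theorem1 (L σ C Cφ D₁ : ℝ) (hL : 0 < L) (hσ : 0 < σ) (hC : 1 ≤ C) (hCφ : 0 < Cφ)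
    (hD₁ : 0 < D₁) :
    ∃ Ξ : ℝ, 0 < Ξ ∧
      ∀ (n d : ℕ), 1 ≤ n → 1 ≤ d →
      -- Dirichlet parameters
      ∀ α : Fin d → ℝ, ∑ i, α i = 1 → (∀ i, D₁ / d ≤ α i) →
      -- interval of definition and dictionary
      ∀ (I : Set ℝ), I.OrdConnected → ∀ φ : ℕ → ℝ → ℝ, IsDictionary φ I Cφ →
      -- law of (X, Y) and true parameters
      ∀ (P : Measure (Mat d × ℝ)) [IsProbabilityMeasure P],
      ∀ Bs ∈ unitSymm d, ∀ fs : ℝ → ℝ, Measurable fs →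
      AssumptionN P Bs fs σ L → AssumptionB P fs I C →
      (∀ᵐ z ∂P, pairing z.1 Bs ∈ I) → (∀ B ∈ unitPSD d, ∀ᵐ z ∂P, pairing z.1 B ∈ I) →
      ∀ δ : ℝ, 0 < δ → δ < 1 →
      ENNReal.ofReal (1 - δ) ≤
        ∫⁻ S : Fin n → Mat d × ℝ,
          gibbs α φ C (invTemp n C σ L) S
            {θ | ∀ M : ℕ, 1 ≤ M → M ≤ n → ∀ B ∈ unitPSD d, ∀ f ∈ approxClass φ M C,
              risk P θ.1 (link φ θ.2) - risk P Bs fs ≤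
                Ξ * (risk P B f - risk P Bs fs + complexity n d M B.rank C δ)}
        ∂(Measure.pi fun _ : Fin n => P) := by
  obtain ⟨hκ, -⟩ := temperature_bounds (σ := σ) hL hC
  have hΞ : 0 < oracleConst L σ C Cφ D₁ := by
    have hlogC : 0 ≤ Real.log (10 * (C + 1)) := Real.log_nonneg (by linarith)
    unfold oracleConst
    positivity
  refine ⟨2 * oracleConst L σ C Cφ D₁, by positivity, ?_⟩
  intro n d hn hd α hα1 hα I hIc φ hφ P _ Bs _ fs hfs hN hB hIs hI δ hδ0 hδ1
  set V : Set ℝ := {v | ∃ M : ℕ, 1 ≤ M ∧ M ≤ n ∧ ∃ B ∈ unitPSD d, ∃ f ∈ approxClass φ M C,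
    v = risk P B f - risk P Bs fs + complexity n d M B.rank C δ} with hV
  have hcore := fun {M : ℕ} (hM : 1 ≤ M) (hMn : M ≤ n) {B : Mat d} (hBu : B ∈ unitPSD d)
    {f : ℝ → ℝ} (hf : f ∈ approxClass φ M C) => oracle_inequality_of_competitor (α := α) hL hC hCφ
      hD₁ hn hd hα1 hα hIc hφ hfs hN hB hIs hI hδ0 hδ1 hM hMn hBu hf
  have hc : (0 : ℝ) < 1 / (2 * n) := by
    have : (0 : ℝ) < n := by exact_mod_cast hn
    positivity
  have hV0 : ∀ v ∈ V, 1 / (2 * n) ≤ v := by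
    rintro v ⟨M, hM, hMn, B, hBu, f, hf, rfl⟩
    exact (hcore hM hMn hBu hf).1
  rcases V.eq_empty_or_nonempty with hempty | hne
  -- Without competitors the event is the whole space.
  · have hd0 : (0 : ℝ) < d := by exact_mod_cast hd
    have hαpos : ∀ i, 0 < α i := fun i => (by positivity : 0 < D₁ / d).trans_le (hα i)
    have huniv : ∀ S : Fin n → Mat d × ℝ, gibbs α φ C (invTemp n C σ L) S
        {θ | ∀ M : ℕ, 1 ≤ M → M ≤ n → ∀ B ∈ unitPSD d, ∀ f ∈ approxClass φ M C,
          risk P θ.1 (link φ θ.2) - risk P Bs fs ≤ 2 * oracleConst L σ C Cφ D₁ *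
            (risk P B f - risk P Bs fs + complexity n d M B.rank C δ)} = 1 := by
      intro S
      have := isProbabilityMeasure_gibbs (n := n) hφ hn (zero_le_one.trans hC) hαpos
        (lam := invTemp n C σ L) (div_nonneg (by positivity) hκ.le) S
      refine Eq.trans ?_ this.measure_univ
      congr 1
      refine Set.eq_univ_of_forall fun θ M hM hMn B hBu f hf => ?_
      exact absurd (show _ ∈ V from ⟨M, hM, hMn, B, hBu, f, hf, rfl⟩) (by simp [hempty])
    simp only [huniv, lintegral_const, measure_univ, mul_one]
    rw [← ENNReal.ofReal_one]
    exact ENNReal.ofReal_le_ofReal (by linarith)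
  · have hbdd : BddBelow V := ⟨_, hV0⟩
    -- The infimum need not be attained, but it is at least 1/(2n) > 0, so some value lies below
    -- twice the infimum. The event for that single competitor implies the inequality for every
    -- other one, with the constant doubled.
    have hnear : ∃ v ∈ V, ∀ w ∈ V, v ≤ 2 * w := by
      have hinf := le_csInf hne hV0
      obtain ⟨v, hv, hlt⟩ := exists_lt_of_csInf_lt hne (show sInf V < 2 * sInf V by linarith)
      exact ⟨v, hv, fun w hw => hlt.le.trans (by linarith [csInf_le hbdd hw])⟩
    obtain ⟨v, ⟨M, hM, hMn, B, hBu, f, hf, rfl⟩, hle⟩ := hnear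
    refine (hcore hM hMn hBu hf).2.trans (lintegral_mono fun S => measure_mono ?_)
    intro θ hθ M' hM' hMn' B' hBu' f' hf'
    have h := hle _ ⟨M', hM', hMn', B', hBu', f', hf', rfl⟩
    refine (show risk P θ.1 (link φ θ.2) - risk P Bs fs ≤ _ from hθ).trans ?_
    calc _ ≤ oracleConst L σ C Cφ D₁ * (2 * _) := mul_le_mul_of_nonneg_left h hΞ.le
      _ = _ := by ring
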